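/- Let $\mathbb K=\mathbb R$ or $\mathbb C$, and let $C^\infty(S^{1|1})$ be the superalgebra of functions $F=f_0(x)+f_1(x)\theta$ with $f_0,f_1$ smooth $\mathbb K$-valued functions on $S^1$ and $\theta$ odd. Put $\eta=\partial_\theta+\theta\partial_x$, $\bar\eta=\partial_\theta-\theta\partial_x$, $\sigma(F)=(-1)^{p(F)}F$, and let $\mathcal K(1)$ be the Lie superalgebra of the contact vector fields $v_F=F\eta^2+\tfrac12\eta(F)\bar\eta$. Let $\mathcal S\Psi\mathcal{DO}$ be the associative superalgebra of formal series $\sum_{k\ge 0}F_k\eta^{w-k}$ ($w\in\mathbb Z$, $F_k\in C^\infty(S^{1|1})$) with $$F\eta^m\circ G\eta^n=\sum_{k\ge0}\binom mk_{\!s}F\,\eta^k(\sigma^{m-k}(G))\,\eta^{m+n-k},\qquad \binom mk_{\!s}=\begin{cases}\binom{\lfloor m/2\rfloor}{\lfloor k/2\rfloor}&\text{if $k$ is even or $m$ is odd},\\ 0&\text{otherwise,}\end{cases}$$ and let $\mathcal S\Psi\mathcal{DO}_{SL}$ be the same superspace with the supercommutator. Let $\rho:\mathcal K(1)\to\mathcal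 S\Psi\mathcal{DO}_{SL}$, $\rho(v_F)=F\eta^2+\frac12\eta(F)\bar\eta$, be the standard embedding, and let $$\Theta_1(v_F)=\eta^2(F),$$ $$\Theta_2(v_F)=\sum_{n\ge1}(-1)^n\Big(\tfrac{n-2}{n}\,\sigma(\bar\eta^{2n+1}(F))\,\bar\eta^{-2n+1}+\tfrac{n-3}{n+1}\,\bar\eta^{2n+2}(F)\,\bar\eta^{-2n}\Big),$$ $$\Theta_3(v_F)=\sum_{n\ge2}(-1)^n\Big(\tfrac{2(n-1)}{n}\,\sigma(\bar\eta^{2n+1}(F))\,\bar\eta^{-2n+1}+\tfrac{2(n-1)}{n+1}\,\bar\eta^{2n+2}(F)\,\bar\eta^{-2n}\Big)$$ (so the leading term of $\Theta_3$ is $\sigma(\bar\eta^5(F))\bar\eta^{-3}$). A *polynomial deformation* of $\rho$ is a family of even Lie superalgebra homomorphisms $\varphi(t)=\rho+\sum_{k\in\mathbb Z}\varphi_k(t):\mathcal K(1)\to\mathcal S\Psi\mathcal{DO}_{SL}$, $t\in\mathbb K^n$ for some $n$, where the component $\varphi_k(t)$ in degree $k$ is a polynomial in $t$ whose coefficients are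 differential operators in $F$, $\varphi_k(0)=0$, and $\varphi_k\equiv0$ for all sufficiently large $k$. For $c_1,c_2,c_3\in\mathbb K$, the infinitesimal deformation $\rho+c_1\Theta_1+c_2\Theta_2+c_3\Theta_3$ *corresponds to a polynomial deformation* if there are a polynomial deformation $\varphi$ and polynomials $\gamma_1,\gamma_2,\gamma_3$ in $t$ such that $$\varphi(t)=\rho+\gamma_1(t)\Theta_1+\gamma_2(t)\Theta_2+\gamma_3(t)\Theta_3+R(t),$$ where $R(t)$ contains only monomials of degree at least $2$ in $t$ and takes values in the operators that involve only $\eta^{-4},\eta^{-5},\dots$, and such that $\gamma(t)=(c_1,c_2,c_3)$ for some $t$. **Theorem.** For all $c_1,c_2,c_3\in\mathbb K$, the infinitesimal deformation $\rho+c_1\Theta_1+c_2\Theta_2+c_3\Theta_3$ corresponds to a polynomial deformation if and only if $$\begin{cases}3c_1c_3-2c_1^3-2c_1^2c_3+c_1^2+2c_3^2=0\\ c_1=c_2\end{cases}\qquad\text{or}\qquad\begin{cases}c_3c_1-2c_3c_1^2-2c_3^2=0\\ c_2=0.\end{cases}$$ -/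

import Mathlib

open scoped ContDiff

namespace SuperCircle

variable {𝕜 : Type*} [RCLike 𝕜]

/-! ## Functions on the circle and on the supercircle -/

/-- Smooth `2π`-periodic functions of a real variable `x` with values in `𝕜`. -/
def circleSubalgebra (𝕜 : Type*) [RCLike 𝕜] : Subalgebra 𝕜 (ℝ → 𝕜) where
  carrier := {f | ContDiff ℝ ∞ f ∧ Function.Periodic f (2 * Real.pi)}
  mul_mem' := fun ha hb => ⟨ha.1.mul hb.1, ha.2.mul hb.2⟩
  add_mem' := fun ha hb => ⟨ha.1.add hb.1, ha.2.add hb.2⟩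
  algebraMap_mem' := fun _ => ⟨contDiff_const, fun _ => rfl⟩

/-- The algebra of smooth `𝕜`-valued functions on the circle. -/
def CircleFun (𝕜 : Type*) [RCLike 𝕜] : Type _ := circleSubalgebra 𝕜

noncomputable instance : CommRing (CircleFun 𝕜) :=
  inferInstanceAs (CommRing (circleSubalgebra 𝕜))

noncomputable instance : Algebra 𝕜 (CircleFun 𝕜) :=
  inferInstanceAs (Algebra 𝕜 (circleSubalgebra 𝕜))

/-- The derivative `f ↦ f'` on functions on the circle. -/
noncomputable def circleDeriv : CircleFun 𝕜 →ₗ[𝕜] CircleFun 𝕜 where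
  toFun f := ⟨deriv f.1, by
    refine ⟨(contDiff_infty_iff_deriv.1 f.2.1).2, fun x => ?_⟩
    have h : (fun y => f.1 (y + 2 * Real.pi)) = f.1 := funext f.2.2
    rw [← deriv_comp_add_const, h]⟩
  map_add' f g := by
    refine Subtype.ext (funext fun x => ?_)
    exact deriv_add (f.2.1.differentiable (by simp) x) (g.2.1.differentiable (by simp) x)
  map_smul' a f := by
    refine Subtype.ext (funext fun x => ?_)
    exact deriv_const_mul a (f.2.1.differentiable (by simp) x)

theorem circleDeriv_mul (f g : CircleFun 𝕜) :
    circleDeriv (f * g) = circleDeriv f * g + f * circleDeriv g := by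
  refine Subtype.ext (funext fun x => ?_)
  exact deriv_mul (f.2.1.differentiable (by simp) x) (g.2.1.differentiable (by simp) x)

/-- Smooth functions on the supercircle `S^{1|1}`: expressions `f₀ + f₁ θ` with `θ² = 0`.
The dual number `F` has components `F.fst = f₀` and `F.snd = f₁`; since the coefficients are
ordinary (even) functions, the supercommutative product is the product of dual numbers. -/
abbrev SFun (𝕜 : Type*) [RCLike 𝕜] : Type _ := DualNumber (CircleFun 𝕜)

/-- The function `f₀ + f₁ θ`. -/
noncomputable def SFun.mk (f₀ f₁ : CircleFun 𝕜) : SFun 𝕜 :=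
  TrivSqZeroExt.inl f₀ + TrivSqZeroExt.inr f₁

/-- The odd coordinate `θ`. -/
noncomputable def theta : SFun 𝕜 := SFun.mk 0 1

/-- The parity involution `σ(F) = (-1)^{p(F)} F`. -/
noncomputable def sigma : SFun 𝕜 →ₗ[𝕜] SFun 𝕜 where
  toFun F := SFun.mk F.fst (-F.snd)
  map_add' F G := by ext <;> simp [SFun.mk, add_comm]
  map_smul' a F := by ext <;> simp [SFun.mk]

/-- `σ^j` for an integer `j`. -/
noncomputable def sigmaPow (j : ℤ) (F : SFun 𝕜) : SFun 𝕜 := if Even j then F else sigma F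

/-- The vector field `∂/∂x`. -/
noncomputable def dx : SFun 𝕜 →ₗ[𝕜] SFun 𝕜 where
  toFun F := SFun.mk (circleDeriv F.fst) (circleDeriv F.snd)
  map_add' F G := by ext <;> simp [SFun.mk]
  map_smul' a F := by ext <;> simp [SFun.mk]

/-- The odd vector field `η = ∂/∂θ + θ ∂/∂x`. -/
noncomputable def eta : SFun 𝕜 →ₗ[𝕜] SFun 𝕜 where
  toFun F := SFun.mk F.snd (circleDeriv F.fst)
  map_add' F G := by ext <;> simp [SFun.mk]
  map_smul' a F := by ext <;> simp [SFun.mk]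

/-- The odd vector field `η̄ = ∂/∂θ - θ ∂/∂x`. -/
noncomputable def etaBar : SFun 𝕜 →ₗ[𝕜] SFun 𝕜 where
  toFun F := SFun.mk F.snd (-circleDeriv F.fst)
  map_add' F G := by ext <;> simp [SFun.mk, add_comm]
  map_smul' a F := by ext <;> simp [SFun.mk]

/-- The components of given parity: `superPart 0 F` is even and `superPart 1 F` is odd. -/
noncomputable def superPart (i : Fin 2) (F : SFun 𝕜) : SFun 𝕜 :=
  if i = 0 then SFun.mk F.fst 0 else SFun.mk 0 F.snd

theorem fst_dx (F : SFun 𝕜) : (dx F).fst = circleDeriv F.fst := by simp [dx, SFun.mk]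

theorem snd_dx (F : SFun 𝕜) : (dx F).snd = circleDeriv F.snd := by simp [dx, SFun.mk]

theorem fst_eta (F : SFun 𝕜) : (eta F).fst = F.snd := by simp [eta, SFun.mk]

theorem snd_eta (F : SFun 𝕜) : (eta F).snd = circleDeriv F.fst := by simp [eta, SFun.mk]

theorem fst_etaBar (F : SFun 𝕜) : (etaBar F).fst = F.snd := by simp [etaBar, SFun.mk]

theorem snd_etaBar (F : SFun 𝕜) : (etaBar F).snd = -circleDeriv F.fst := by
  simp [etaBar, SFun.mk]

theorem fst_superPart (i : Fin 2) (F : SFun 𝕜) :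
    (superPart i F).fst = if i = 0 then F.fst else 0 := by
  unfold superPart
  split_ifs <;> simp [SFun.mk]

theorem snd_superPart (i : Fin 2) (F : SFun 𝕜) :
    (superPart i F).snd = if i = 0 then 0 else F.snd := by
  unfold superPart
  split_ifs <;> simp [SFun.mk]

/-! ## The Lie superalgebra of contact vector fields -/

/-- The contact vector field `v_F = F ∂/∂x + ½ η(F) η̄`, acting on functions. The Lie superalgebra
`K(1)` consists of these vector fields; as a superspace it is identified with `SFun 𝕜`
by `F ↦ v_F`. -/
noncomputable def contactField (F : SFun 𝕜) : Module.End 𝕜 (SFun 𝕜) :=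
  LinearMap.mulLeft 𝕜 F ∘ₗ dx + (2⁻¹ : 𝕜) • (LinearMap.mulLeft 𝕜 (eta F) ∘ₗ etaBar)

/-- The bracket of `K(1)` in terms of generating functions, so that
`[v_F, v_G] = v_{contactBracket F G}` (see `contactField_contactBracket`). -/
noncomputable def contactBracket (F G : SFun 𝕜) : SFun 𝕜 :=
  F * dx G - dx F * G + (2⁻¹ : 𝕜) • (eta F * etaBar G)

theorem fst_contactField (F H : SFun 𝕜) : (contactField F H).fst =
    F.fst * circleDeriv H.fst + (2⁻¹ : 𝕜) • (F.snd * H.snd) := by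
  simp [contactField, fst_dx, fst_eta, fst_etaBar]

theorem snd_contactField (F H : SFun 𝕜) : (contactField F H).snd =
    F.fst * circleDeriv H.snd + F.snd * circleDeriv H.fst +
      (2⁻¹ : 𝕜) • (circleDeriv F.fst * H.snd - F.snd * circleDeriv H.fst) := by
  simp [contactField, fst_dx, snd_dx, fst_eta, fst_etaBar, snd_eta, snd_etaBar,
    sub_eq_neg_add, smul_add]

theorem fst_contactBracket (F G : SFun 𝕜) : (contactBracket F G).fst =
    F.fst * circleDeriv G.fst - circleDeriv F.fst * G.fst + (2⁻¹ : 𝕜) • (F.snd * G.snd) := by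
  simp [contactBracket, fst_dx, fst_eta, fst_etaBar]

theorem snd_contactBracket (F G : SFun 𝕜) : (contactBracket F G).snd =
    F.fst * circleDeriv G.snd + F.snd * circleDeriv G.fst - (circleDeriv F.fst * G.snd +
      circleDeriv F.snd * G.fst) +
      (2⁻¹ : 𝕜) • (circleDeriv F.fst * G.snd - F.snd * circleDeriv G.fst) := by
  simp [contactBracket, fst_dx, snd_dx, fst_eta, fst_etaBar, snd_eta, snd_etaBar,
    sub_eq_neg_add, smul_add]

/-- The contact bracket is the supercommutator of vector fields: on homogeneous generating
functions of parities `i` and `j`, it is `v_F v_G - (-1)^{ij} v_G v_F`. -/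
theorem contactField_contactBracket (i j : Fin 2) (F G : SFun 𝕜) :
    contactField (contactBracket (superPart i F) (superPart j G)) =
      contactField (superPart i F) * contactField (superPart j G) -
        (-1 : 𝕜) ^ ((i : ℕ) * (j : ℕ)) •
          (contactField (superPart j G) * contactField (superPart i F)) := by
  refine LinearMap.ext fun H => ?_
  have h1 : ∀ a : CircleFun 𝕜, (2⁻¹ : 𝕜) • a + (2⁻¹ : 𝕜) • a = a := fun a => by
    rw [← add_smul, ← two_mul, mul_inv_cancel₀ two_ne_zero, one_smul]
  obtain ⟨k, hk, hs⟩ : ∃ k : CircleFun 𝕜, 2 * k = 1 ∧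
      ∀ a : CircleFun 𝕜, (2⁻¹ : 𝕜) • a = k * a := by
    refine ⟨(2⁻¹ : 𝕜) • 1, ?_, fun a => by rw [smul_mul_assoc, one_mul]⟩
    rw [two_mul, h1]
  have hd : ∀ a : CircleFun 𝕜, circleDeriv (k * a) = k * circleDeriv a := fun a => by
    rw [← hs, map_smul, hs]
  rw [LinearMap.sub_apply, LinearMap.smul_apply, Module.End.mul_apply, Module.End.mul_apply]
  have hi : i = 0 ∨ i = 1 := by omega
  have hj : j = 0 ∨ j = 1 := by omega
  clear h1
  rcases hi with rfl | rfl <;> rcases hj with rfl | rfl <;>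
  apply TrivSqZeroExt.ext <;>
  simp only [TrivSqZeroExt.fst_sub, TrivSqZeroExt.snd_sub,
    fst_contactField, snd_contactField, fst_contactBracket,
    snd_contactBracket, fst_superPart, snd_superPart, hs, map_add, map_sub, hd, circleDeriv_mul,
    if_true, one_ne_zero, if_false, map_zero, Fin.val_zero, Fin.val_one, mul_zero, zero_mul,
    pow_zero, pow_one, one_smul, neg_smul, mul_one,
    TrivSqZeroExt.fst_neg, TrivSqZeroExt.snd_neg]
  · ring
  · ring
  · linear_combination k * circleDeriv F.fst * G.snd * H.snd * hk
  · ring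
  · linear_combination -k * F.snd * circleDeriv G.fst * H.snd * hk
  · ring
  · linear_combination k * F.snd * G.snd * circleDeriv H.fst * hk
  · linear_combination k * (F.snd * G.snd * circleDeriv H.snd +
      F.snd * circleDeriv G.snd * H.snd + G.snd * circleDeriv F.snd * H.snd) * hk

/-! ## Superpseudodifferential operators -/

/-- Superpseudodifferential operators `∑ F_k η^k`, where `k` ranges over the integers and
`F_k = 0` for all sufficiently large `k`. -/
def SPDO (𝕜 : Type*) [RCLike 𝕜] : Submodule 𝕜 (ℤ → SFun 𝕜) where
  carrier := {A | ∃ N : ℤ, ∀ k, N < k → A k = 0}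
  add_mem' := by
    rintro A B ⟨M, hM⟩ ⟨N, hN⟩
    refine ⟨max M N, fun k hk => ?_⟩
    rw [Pi.add_apply, hM k (lt_of_le_of_lt (le_max_left _ _) hk),
      hN k (lt_of_le_of_lt (le_max_right _ _) hk), add_zero]
  zero_mem' := ⟨0, fun _ _ => rfl⟩
  smul_mem' := by
    rintro a A ⟨N, hN⟩
    exact ⟨N, fun k hk => by rw [Pi.smul_apply, hN k hk, smul_zero]⟩

/-- The operator `F η^m`. -/
noncomputable def monomial (m : ℤ) (F : SFun 𝕜) : SPDO 𝕜 :=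
  ⟨Pi.single m F, m, fun _ hk => Pi.single_eq_of_ne hk.ne' _⟩

/-- Left multiplication of an operator by a function. -/
noncomputable def leftMul (F : SFun 𝕜) (A : SPDO 𝕜) : SPDO 𝕜 :=
  ⟨fun k => F * A.1 k, by
    obtain ⟨N, hN⟩ := A.2
    exact ⟨N, fun k hk => by simp [hN k hk]⟩⟩

/-- The super binomial coefficients: `binom ⌊m/2⌋ ⌊k/2⌋` if `k` is even or `m` is odd, and `0`
otherwise. The division is the floor division of integers, and `Ring.choose a l` is
`a (a - 1) ⋯ (a - l + 1) / l!`. -/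
def superChoose (m : ℤ) (k : ℕ) : ℤ :=
  if Even k ∨ Odd m then Ring.choose (m / 2) (k / 2) else 0

/-- The coefficient of `η^N` in `(F η^m) ∘ (G η^n)`, which is
`∑_{k ≥ 0} superChoose m k • F η^k(σ^{m-k}(G)) η^{m+n-k}`. -/
noncomputable def compTerm (m : ℤ) (F : SFun 𝕜) (n : ℤ) (G : SFun 𝕜) (N : ℤ) : SFun 𝕜 :=
  if N ≤ m + n then
    superChoose m (m + n - N).toNat •
      (F * (eta ^ (m + n - N).toNat) (sigmaPow (m - (m + n - N)) G))
  else 0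

/-- The double sum defining each coefficient of a composition is finite. -/
theorem compTerm_support_finite (A B : SPDO 𝕜) (N : ℤ) :
    (Function.support fun p : ℤ × ℤ => compTerm p.1 (A.1 p.1) p.2 (B.1 p.2) N).Finite := by
  obtain ⟨a, ha⟩ := A.2
  obtain ⟨b, hb⟩ := B.2
  refine ((Set.finite_Icc (N - b) a).prod (Set.finite_Icc (N - a) b)).subset ?_
  rintro ⟨m, n⟩ h
  have hm : m ≤ a := by
    by_contra hc
    exact h (by simp [compTerm, ha m (not_le.1 hc)])
  have hn : n ≤ b := by
    by_contra hc
    exact h (by simp [compTerm, sigmaPow, hb n (not_le.1 hc)])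
  have hN : N ≤ m + n := by
    by_contra hc
    exact h (by simp [compTerm, hc])
  simp only [Set.mem_prod, Set.mem_Icc]
  omega

/-- The composition of superpseudodifferential operators. -/
noncomputable def comp (A B : SPDO 𝕜) : SPDO 𝕜 :=
  ⟨fun N => ∑ᶠ p : ℤ × ℤ, compTerm p.1 (A.1 p.1) p.2 (B.1 p.2) N, by
    obtain ⟨a, ha⟩ := A.2
    obtain ⟨b, hb⟩ := B.2
    refine ⟨a + b, fun N hN => ?_⟩
    refine finsum_eq_zero_of_forall_eq_zero ?_
    rintro ⟨m, n⟩
    by_cases hm : a < m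
    · simp [compTerm, ha m hm]
    by_cases hn : b < n
    · simp [compTerm, sigmaPow, hb n hn]
    · have : ¬ N ≤ m + n := by omega
      simp [compTerm, this]⟩

/-- The components of given parity of an operator; the parity of `F η^k` is `p(F) + k`. -/
noncomputable def opPart (i : Fin 2) (A : SPDO 𝕜) : SPDO 𝕜 :=
  ⟨fun k => if Even k then superPart i (A.1 k) else superPart (i + 1) (A.1 k), by
    obtain ⟨N, hN⟩ := A.2
    exact ⟨N, fun k hk => by simp [hN k hk, superPart, SFun.mk]⟩⟩

/-- The supercommutator, `[A, B] = A ∘ B - (-1)^{p(A) p(B)} B ∘ A` on homogeneous elements,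
extended bilinearly. -/
noncomputable def superBracket (A B : SPDO 𝕜) : SPDO 𝕜 :=
  ∑ i : Fin 2, ∑ j : Fin 2,
    (comp (opPart i A) (opPart j B) -
      (-1 : 𝕜) ^ ((i : ℕ) * (j : ℕ)) • comp (opPart j B) (opPart i A))

/-- The powers `η̄^j`, `j ∈ ℤ`, of the operator `η̄ = η - 2θη²`. Since `η̄² = -η²`, one has
`η̄^{2i} = (-1)^i η^{2i}` and `η̄^{2i+1} = (-1)^i (η - 2θη²) η^{2i}`. -/
noncomputable def etaBarPow (j : ℤ) : SPDO 𝕜 :=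
  if Even j then ((j / 2).negOnePow : ℤ) • monomial j 1
  else ((j / 2).negOnePow : ℤ) • (monomial j 1 - (2 : 𝕜) • monomial (j + 1) theta)

/-! ## The embedding of `K(1)` and the cocycles -/

/-- The standard embedding `ρ(v_F) = F η² + ½ η(F) η̄`. -/
noncomputable def rho (F : SFun 𝕜) : SPDO 𝕜 :=
  monomial 2 F + (2⁻¹ : 𝕜) • leftMul (eta F) (etaBarPow 1)

/-- The cocycle `Θ₁(v_F) = η²(F)`. -/
noncomputable def Theta1 (F : SFun 𝕜) : SPDO 𝕜 := monomial 0 ((eta ^ 2) F)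

/-- The expression
`(-1)^n (a σ(η̄^{2n+1}(F)) η̄^{-2n+1} + b η̄^{2n+2}(F) η̄^{-2n})`. -/
noncomputable def cocycleTerm (a b : 𝕜) (n : ℕ) (F : SFun 𝕜) : SPDO 𝕜 :=
  (-1 : 𝕜) ^ n •
    (a • leftMul (sigma ((etaBar ^ (2 * n + 1)) F)) (etaBarPow (-2 * n + 1)) +
      b • leftMul ((etaBar ^ (2 * n + 2)) F) (etaBarPow (-2 * n)))

/-- `cocycleTerm a b n F` only involves `η^k` with `k ≤ 2 - 2n`. -/
theorem cocycleTerm_eq_zero (a b : 𝕜) (n : ℕ) (F : SFun 𝕜) (k : ℤ) (hk : 2 - 2 * (n : ℤ) < k) :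
    (cocycleTerm a b n F).1 k = 0 := by
  have h1 : ∀ (m : ℤ) (G : SFun 𝕜), m < k → (monomial m G).1 k = 0 :=
    fun m G hm => Pi.single_eq_of_ne hm.ne' _
  have h2 : ∀ m : ℤ, m + 1 < k → (etaBarPow (𝕜 := 𝕜) m).1 k = 0 := by
    intro m hm
    unfold etaBarPow
    split_ifs
    · simp [h1 m _ (by omega)]
    · simp [h1 m _ (by omega), h1 (m + 1) _ hm]
  have h3 : (etaBarPow (𝕜 := 𝕜) (-2 * n + 1)).1 k = 0 := h2 _ (by omega)
  have h4 : (etaBarPow (𝕜 := 𝕜) (-2 * n)).1 k = 0 := h2 _ (by omega)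
  simp [cocycleTerm, leftMul, -neg_mul, h3, h4]

/-- The formal series `∑_{n ≥ 1} cocycleTerm (a n) (b n) n F`. Only the terms with
`2n ≤ 2 - k` contribute to the coefficient of `η^k` (see `cocycleTerm_eq_zero`), so that each
coefficient is a finite sum. -/
noncomputable def cocycleSeries (a b : ℕ → 𝕜) (F : SFun 𝕜) : SPDO 𝕜 :=
  ⟨fun k => ∑ n ∈ Finset.Icc 1 (2 - k).toNat, (cocycleTerm (a n) (b n) n F).1 k, by
    refine ⟨0, fun k hk => Finset.sum_eq_zero fun n hn => cocycleTerm_eq_zero _ _ _ _ _ ?_⟩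
    have := (Finset.mem_Icc.1 hn).1
    omega⟩

/-- The cocycle `Θ₂(v_F) = ∑_{n ≥ 1} (-1)^n (n-2)/n σ(η̄^{2n+1}(F)) η̄^{-2n+1}
+ ∑_{n ≥ 1} (-1)^n (n-3)/(n+1) η̄^{2n+2}(F) η̄^{-2n}`. -/
noncomputable def Theta2 (F : SFun 𝕜) : SPDO 𝕜 :=
  cocycleSeries (fun n => ((n : 𝕜) - 2) / n) (fun n => ((n : 𝕜) - 3) / (n + 1)) F

/-- The cocycle `Θ₃(v_F) = ∑_{n ≥ 2} (-1)^n 2(n-1)/n σ(η̄^{2n+1}(F)) η̄^{-2n+1}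
+ ∑_{n ≥ 2} (-1)^n 2(n-1)/(n+1) η̄^{2n+2}(F) η̄^{-2n}`, normalized so that its leading term is
`σ(η̄⁵(F)) η̄^{-3}`. (The terms with `n = 1` vanish.) -/
noncomputable def Theta3 (F : SFun 𝕜) : SPDO 𝕜 :=
  cocycleSeries (fun n => 2 * ((n : 𝕜) - 1) / n) (fun n => 2 * ((n : 𝕜) - 1) / (n + 1)) F

/-- The infinitesimal deformation `ρ + c₁ Θ₁ + c₂ Θ₂ + c₃ Θ₃`. -/
noncomputable def infinitesimalDeformation (c₁ c₂ c₃ : 𝕜) (F : SFun 𝕜) : SPDO 𝕜 :=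
  rho F + c₁ • Theta1 F + c₂ • Theta2 F + c₃ • Theta3 F

/-! ## Polynomial deformations -/

/-- `φ` is a homomorphism of Lie superalgebras from `K(1)` to the superpseudodifferential
operators with the supercommutator: an even linear map that preserves brackets. -/
structure IsSuperLieHom (φ : SFun 𝕜 → SPDO 𝕜) : Prop where
  isLinear : IsLinearMap 𝕜 φ
  even : ∀ (i : Fin 2) (F : SFun 𝕜), φ (superPart i F) = opPart i (φ F)
  map_bracket : ∀ F G : SFun 𝕜, φ (contactBracket F G) = superBracket (φ F) (φ G)

/-- `D` is a differential operator on the supercircle: a finite sum `∑ a_j η^j` with smooth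
coefficients. (As `η² = ∂/∂x`, these are the usual ones.) -/
def IsDiffOp (D : SFun 𝕜 → SFun 𝕜) : Prop :=
  ∃ (r : ℕ) (a : ℕ → SFun 𝕜), ∀ F, D F = ∑ j ∈ Finset.range r, a j * (eta ^ j) F

/-- A family of maps `R(t)` from `K(1)` to superpseudodifferential operators, `t ∈ 𝕜^n`, is
polynomial in `t` with differentiable coefficients and only with monomials of degree at least `d`:
for each `k`, the coefficient of `η^k` in `R(t)(v_F)` is a finite sum `∑ t^α D_α(F)` over
multi-indices with `|α| ≥ d`, where the `D_α` are differential operators. -/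
def IsPolynomialFamily {n : ℕ} (d : ℕ) (R : (Fin n → 𝕜) → SFun 𝕜 → SPDO 𝕜) : Prop :=
  ∀ k : ℤ, ∃ (s : Finset (Fin n →₀ ℕ)) (D : (Fin n →₀ ℕ) → SFun 𝕜 → SFun 𝕜),
    (∀ α ∈ s, d ≤ α.degree ∧ IsDiffOp (D α)) ∧
      ∀ t F, (R t F).1 k = ∑ α ∈ s, (α.prod fun i e => t i ^ e) • D α F

/-- A polynomial deformation of the standard embedding `ρ`, with parameters `t ∈ 𝕜^n`: a family of
homomorphisms `φ(t) = ρ + ∑_k φ_k(t)`, where the component `φ_k(t)` in each degree is polynomial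
in `t` (with differentiable coefficients), vanishes for `t = 0`, and is zero for all sufficiently
large degrees. -/
structure IsPolynomialDeformation {n : ℕ} (φ : (Fin n → 𝕜) → SFun 𝕜 → SPDO 𝕜) : Prop where
  hom : ∀ t, IsSuperLieHom (φ t)
  polynomial : IsPolynomialFamily 0 (fun t F => φ t F - rho F)
  at_zero : ∀ F, φ 0 F = rho F
  bounded : ∃ N : ℤ, ∀ t F k, N < k → (φ t F - rho F).1 k = 0

/-- The order of `A`, as the largest `k` such that `η^{2k}` or `η^{2k-1}` occurs in `A`, is at
most `-2`: only `η^{-4}, η^{-5}, …` occur. -/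
def OrderLeNegTwo (A : SPDO 𝕜) : Prop := ∀ k : ℤ, -4 < k → A.1 k = 0

/-- The infinitesimal deformation `ρ + c₁ Θ₁ + c₂ Θ₂ + c₃ Θ₃` corresponds to a polynomial
deformation: there are a polynomial deformation `φ(t)` of `ρ` and polynomials `γ₁, γ₂, γ₃` in `t`
such that
`φ(t) = ρ + γ₁(t) Θ₁ + γ₂(t) Θ₂ + γ₃(t) Θ₃ + R(t)`,
with a remainder `R(t)` that contains only monomials of degree at least two in `t` and only
terms in `η^{-4}, η^{-5}, …`, and such that `γ` takes the value `(c₁, c₂, c₃)`. -/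
def CorrespondsToPolynomialDeformation (c₁ c₂ c₃ : 𝕜) : Prop :=
  ∃ (n : ℕ) (φ : (Fin n → 𝕜) → SFun 𝕜 → SPDO 𝕜) (γ₁ γ₂ γ₃ : MvPolynomial (Fin n) 𝕜)
    (R : (Fin n → 𝕜) → SFun 𝕜 → SPDO 𝕜),
    IsPolynomialDeformation φ ∧
    (∀ t F, φ t F =
      infinitesimalDeformation (γ₁.eval t) (γ₂.eval t) (γ₃.eval t) F + R t F) ∧
    IsPolynomialFamily 2 R ∧
    (∀ t F, OrderLeNegTwo (R t F)) ∧
    ∃ t, γ₁.eval t = c₁ ∧ γ₂.eval t = c₂ ∧ γ₃.eval t = c₃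

end SuperCircle

/-!
Everything takes place among the operators `stdOp U V F` given by a function `F` and two power
series `U = ∑ uₙ Xⁿ`, `V = ∑ vₙ Xⁿ`: the embedding `ρ` and the cocycles `Θ₁, Θ₂, Θ₃` are of this
form. The conditions of the theorem describe four curves, `(c, 0, 0)`, `(c, c, -c)`,
`(c, c, c² - c/2)` and `(c, 0, c/2 - c²)`.

*The curves are realized.* The operators `ρ(v_F) + l F'` are the action on densities of weight `l`
(`preservesBracket_densityOp`), which gives the first curve. The odd operator `η̄` intertwines the
weights `0` and `1/2`, so that densities of weight `1/2 + c` conjugated by `η̄` are a deformation of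
`ρ` (`preservesBracket_altSeries`), the second curve. Conjugation by `η² = ∂/∂x` multiplies both `U`
and `V` by `1 + X`. Its `μ`-th power multiplies them by `(1 + X)^μ` and preserves brackets for every
natural number `μ`, hence for every scalar `μ`, as brackets depend polynomially on `μ`
(`PreservesBracket.binomialSeries_mul`). Conjugation by powers of `η` that depend linearly on the
parameter turns the first two families into the other two. It remains to compare expansions to first
order in the parameter, and the coefficients of `X^0, X^1, X^2`.

*There are no others.* Let `φ` be a homomorphism that agrees with `ρ + c₁ Θ₁ + c₂ Θ₂ + c₃ Θ₃` in all
degrees above `-4`. On odd elements, `φ(fθ) φ(gθ) + φ(gθ) φ(fθ) = φ(fg/2)` only depends on the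
product `fg`. In degree `-2` this says `c₂ (c₁ - c₂) = 0`. In degrees `-4`, `-5`, `-6` it involves
unknown coefficients of `φ`; for suitable functions `f`, `g`, at the point `x = 0`, these can be
eliminated, which leaves the equations of the theorem (`IsLift.obstruction`).

Associativity of the composition, which underlies all conjugations, is derived from the super
Leibniz rule and the injectivity of left composition with `η` (`comp_assoc`).
-/

namespace SuperCircle

variable {𝕜 : Type*} [RCLike 𝕜]

/-! ### Functions on the supercircle -/

theorem circleDeriv_one : circleDeriv (1 : CircleFun 𝕜) = 0 := by
  simpa using circleDeriv_mul (1 : CircleFun 𝕜) 1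

theorem fst_sigma (F : SFun 𝕜) : (sigma F).fst = F.fst := by simp [sigma, SFun.mk]

theorem snd_sigma (F : SFun 𝕜) : (sigma F).snd = -F.snd := by simp [sigma, SFun.mk]

theorem fst_theta : (theta : SFun 𝕜).fst = 0 := by simp [theta, SFun.mk]

theorem snd_theta : (theta : SFun 𝕜).snd = 1 := by simp [theta, SFun.mk]

theorem sigma_mul (F G : SFun 𝕜) : sigma (F * G) = sigma F * sigma G := by
  ext <;> simp [fst_sigma, snd_sigma]; ring

theorem sigma_sigma (F : SFun 𝕜) : sigma (sigma F) = F := by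
  ext <;> simp [fst_sigma, snd_sigma]

/-- The super Leibniz rule for the odd derivation `η`. -/
theorem eta_mul (F G : SFun 𝕜) : eta (F * G) = eta F * G + sigma F * eta G := by
  ext <;> simp [fst_sigma, snd_sigma, fst_eta, snd_eta, circleDeriv_mul] <;> ring

theorem eta_sigma (F : SFun 𝕜) : eta (sigma F) = -sigma (eta F) := by
  ext <;> simp [fst_sigma, snd_sigma, fst_eta, snd_eta]

theorem eta_eta (F : SFun 𝕜) : eta (eta F) = dx F := by
  ext <;> simp [fst_dx, snd_dx, fst_eta, snd_eta]

theorem sigma_eta_pow (k : ℕ) (F : SFun 𝕜) :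
    sigma ((eta ^ k) F) = (-1 : ℤ) ^ k • (eta ^ k) (sigma F) := by
  induction k with
  | zero => simp
  | succ k ih =>
    rw [pow_succ', pow_succ', Module.End.mul_apply, Module.End.mul_apply]
    have := eta_sigma ((eta ^ k) F)
    rw [ih, map_zsmul] at this
    rw [neg_eq_iff_eq_neg.1 this.symm, neg_one_mul, neg_smul]

theorem sigmaPow_add_one (j : ℤ) (F : SFun 𝕜) : sigmaPow (j + 1) F = sigma (sigmaPow j F) := by
  unfold sigmaPow
  by_cases h : Even j
  · simp [h]
  · simp [h, sigma_sigma]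

theorem sigmaPow_add (j : ℤ) (F G : SFun 𝕜) :
    sigmaPow j (F + G) = sigmaPow j F + sigmaPow j G := by
  unfold sigmaPow; split_ifs <;> simp

theorem sigmaPow_smul (j : ℤ) (a : 𝕜) (F : SFun 𝕜) : sigmaPow j (a • F) = a • sigmaPow j F := by
  unfold sigmaPow; split_ifs <;> simp

/-! ### The associative algebra of superpseudodifferential operators -/

theorem superChoose_zero_right (m : ℤ) : superChoose m 0 = 1 := by simp [superChoose]

/-- The Pascal rule for the super binomial coefficients. -/
theorem superChoose_succ_succ (m : ℤ) (k : ℕ) :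
    superChoose (m + 1) (k + 1) = (-1) ^ (k + 1) * superChoose m (k + 1) + superChoose m k := by
  obtain ⟨l, rfl | rfl⟩ := Int.even_or_odd' m <;> obtain ⟨j, rfl | rfl⟩ := Nat.even_or_odd' k
  · have h1 : (2 * l + 1) / 2 = l := by omega
    have h2 : (2 * j + 1) / 2 = j := by omega
    simp [superChoose, parity_simps, h1, h2]
  · have h1 : (2 * l + 1) / 2 = l := by omega
    have h2 : (2 * j + 1 + 1) / 2 = j + 1 := by omega
    have h3 : Even (2 * j + 1 + 1) := by simp [parity_simps]
    simp [superChoose, parity_simps, h1, h2, h3.neg_one_pow]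
  · have h1 : (2 * l + 1) / 2 = l := by omega
    have h2 : (2 * j + 1) / 2 = j := by omega
    simp [superChoose, parity_simps, h1, h2, pow_succ]
  · have h1 : (2 * l + 1) / 2 = l := by omega
    have h4 : (2 * l + 1 + 1) / 2 = l + 1 := by omega
    have h2 : (2 * j + 1 + 1) / 2 = j + 1 := by omega
    have h5 : (2 * j + 1) / 2 = j := by omega
    have h3 : Even (2 * j + 1 + 1) := by simp [parity_simps]
    simp [superChoose, parity_simps, h1, h2, h3.neg_one_pow, h4, h5, Ring.choose_succ_succ]
    rw [add_comm]

/-- A coefficient of a composition as a finite sum over explicit ranges. -/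
theorem comp_coeff {A B : SPDO 𝕜} {q b : ℤ} (hA : ∀ k, q < k → A.1 k = 0)
    (hB : ∀ k, b < k → B.1 k = 0) (N : ℤ) {p : ℤ} {K : ℕ} (hp : p ≤ N - b)
    (hK : b - N + q < K) :
    (comp A B).1 N = ∑ m ∈ Finset.Icc p q, ∑ k ∈ Finset.range K,
      superChoose m k • (A.1 m * (eta ^ k) (sigmaPow (m - k) (B.1 (N - m + k)))) := by
  have hinj : Function.Injective fun x : ℤ × ℕ => (x.1, N - x.1 + (x.2 : ℤ)) := by
    rintro ⟨a, c⟩ ⟨a', c'⟩ h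
    simp only [Prod.mk.injEq] at h
    obtain ⟨rfl, h⟩ := h
    simp only [Prod.mk.injEq, true_and]
    omega
  change (∑ᶠ x : ℤ × ℤ, compTerm x.1 (A.1 x.1) x.2 (B.1 x.2) N) = _
  rw [finsum_eq_sum_of_support_subset (s := (Finset.Icc p q ×ˢ Finset.range K).map ⟨_, hinj⟩),
    Finset.sum_map, Finset.sum_product]
  · refine Finset.sum_congr rfl fun m _ => Finset.sum_congr rfl fun k _ => ?_
    have h1 : N ≤ m + (N - m + k) := by omega
    have h2 : m + (N - m + k) - N = k := by ring
    simp only [Function.Embedding.coeFn_mk, compTerm, if_pos h1, h2, Int.toNat_natCast]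
  · rintro ⟨m, n⟩ h
    have hm : m ≤ q := by
      by_contra hc
      exact h (by simp [compTerm, hA m (not_le.1 hc)])
    have hn : n ≤ b := by
      by_contra hc
      exact h (by simp [compTerm, sigmaPow, hB n (not_le.1 hc)])
    have hN : N ≤ m + n := by
      by_contra hc
      exact h (by simp [compTerm, hc])
    simp only [Finset.coe_map, Function.Embedding.coeFn_mk, Finset.coe_product, Set.mem_image,
      Set.mem_prod, Finset.coe_Icc, Set.mem_Icc, Finset.coe_range, Set.mem_Iio, Prod.exists,
      Prod.mk.injEq]
    exact ⟨m, (m + n - N).toNat, ⟨⟨by omega, hm⟩, by omega⟩, rfl, by omega⟩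

theorem monomial_same (m : ℤ) (F : SFun 𝕜) : (monomial m F).1 m = F := Pi.single_eq_same _ _

theorem monomial_of_ne {m k : ℤ} (h : k ≠ m) (F : SFun 𝕜) : (monomial m F).1 k = 0 :=
  Pi.single_eq_of_ne h _

/-- The coefficients of `η^m ∘ B`. -/
theorem monomial_one_comp_coeff {B : SPDO 𝕜} {b : ℤ} (hB : ∀ k, b < k → B.1 k = 0) (m N : ℤ)
    {K : ℕ} (hK : b - N + m < K) :
    (comp (monomial m 1) B).1 N = ∑ k ∈ Finset.range K,
      superChoose m k • (eta ^ k) (sigmaPow (m - k) (B.1 (N - m + k))) := by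
  rw [comp_coeff (fun k hk => monomial_of_ne hk.ne' 1) hB N (min_le_left (N - b) m) hK,
    Finset.sum_eq_single m]
  · simp [monomial_same]
  · intro j _ hj
    simp [monomial_of_ne hj]
  · intro h
    exact absurd (Finset.mem_Icc.2 ⟨min_le_right _ _, le_rfl⟩) h

/-- The composition is left linear over functions: `A ∘ B = ∑ A_m (η^m ∘ B)`. -/
theorem comp_coeff_eq_sum {A B : SPDO 𝕜} {q b : ℤ} (hA : ∀ k, q < k → A.1 k = 0)
    (hB : ∀ k, b < k → B.1 k = 0) (N : ℤ) {p : ℤ} (hp : p ≤ N - b) :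
    (comp A B).1 N = ∑ m ∈ Finset.Icc p q, A.1 m * (comp (monomial m 1) B).1 N := by
  obtain ⟨K, hK⟩ : ∃ K : ℕ, b - N + q < K := ⟨(b - N + q + 1).toNat, by omega⟩
  rw [comp_coeff hA hB N hp hK]
  refine Finset.sum_congr rfl fun m hm => ?_
  have hm := (Finset.mem_Icc.1 hm).2
  rw [monomial_one_comp_coeff hB m N (K := K) (by omega), Finset.mul_sum]
  exact Finset.sum_congr rfl fun k _ => (mul_smul_comm _ _ _).symm

/-- A composition of operators of orders at most `q` and `b` has order at most `q + b`. -/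
theorem comp_eq_zero {A B : SPDO 𝕜} {q b : ℤ} (hA : ∀ k, q < k → A.1 k = 0)
    (hB : ∀ k, b < k → B.1 k = 0) {N : ℤ} (hN : q + b < N) : (comp A B).1 N = 0 := by
  rw [comp_coeff_eq_sum hA hB N le_rfl, Finset.Icc_eq_empty (by omega), Finset.sum_empty]

theorem monomial_one_comp_eq_zero {B : SPDO 𝕜} {b : ℤ} (hB : ∀ k, b < k → B.1 k = 0) (m : ℤ)
    {N : ℤ} (hN : m + b < N) : (comp (monomial m 1) B).1 N = 0 :=
  comp_eq_zero (fun _ hk => monomial_of_ne hk.ne' 1) hB hN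

/-- Left composition with `η`, defined coefficientwise by `η ∘ F = σ(F) η + η(F)`; see
`monomial_one_one_comp`. -/
noncomputable def etaLeft : SPDO 𝕜 →ₗ[𝕜] SPDO 𝕜 where
  toFun A := ⟨fun k => sigma (A.1 (k - 1)) + eta (A.1 k), by
    obtain ⟨N, hN⟩ := A.2
    exact ⟨N + 1, fun k hk => by
      beta_reduce
      rw [hN k (by omega), hN (k - 1) (by omega), map_zero, map_zero, add_zero]⟩⟩
  map_add' A B := by
    refine Subtype.ext (funext fun k => ?_)
    simp only [Submodule.coe_add, Pi.add_apply, map_add]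
    abel
  map_smul' a A := by
    refine Subtype.ext (funext fun k => ?_)
    simp

theorem etaLeft_coeff (A : SPDO 𝕜) (k : ℤ) :
    (etaLeft A).1 k = sigma (A.1 (k - 1)) + eta (A.1 k) := rfl

/-- The coefficients of `A` are determined by those of `η ∘ A`, by descending induction on the
degree. -/
theorem etaLeft_injective : Function.Injective (etaLeft (𝕜 := 𝕜)) := by
  refine (injective_iff_map_eq_zero _).2 fun A hA => ?_
  obtain ⟨b, hb⟩ := A.2
  have key : ∀ n : ℕ, ∀ k, b - n < k → A.1 k = 0 := by
    intro n
    induction n with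
    | zero => intro k hk; exact hb k (by simpa using hk)
    | succ n ih =>
      intro k hk
      have h : (etaLeft A).1 (k + 1) = 0 := by rw [hA]; rfl
      rw [etaLeft_coeff, ih (k + 1) (by push_cast at hk; omega), map_zero, add_zero,
        add_sub_cancel_right] at h
      rw [← sigma_sigma (A.1 k), h, map_zero]
  exact Subtype.ext (funext fun k => key (b - k + 1).toNat k (by omega))

/-- The Pascal rule in operator form: `η^{m+1} ∘ B = η ∘ (η^m ∘ B)`, for negative `m` too. -/
theorem monomial_add_one_comp (m : ℤ) (B : SPDO 𝕜) :
    comp (monomial (m + 1) 1) B = etaLeft (comp (monomial m 1) B) := by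
  obtain ⟨b, hb⟩ := B.2
  refine Subtype.ext (funext fun N => ?_)
  obtain ⟨K, hK⟩ : ∃ K : ℕ, b - N + m < K := ⟨(b - N + m + 1).toNat, by omega⟩
  rw [etaLeft_coeff, monomial_one_comp_coeff hb (m + 1) N (K := K + 1) (by push_cast; omega),
    monomial_one_comp_coeff hb m (N - 1) (K := K + 1) (by push_cast; omega),
    monomial_one_comp_coeff hb m N hK, map_sum, map_sum, Finset.sum_range_succ',
    Finset.sum_range_succ' (fun k => sigma _), add_right_comm, ← Finset.sum_add_distrib]
  congr 1
  · refine Finset.sum_congr rfl fun k _ => ?_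
    rw [superChoose_succ_succ, map_zsmul, map_zsmul, sigma_eta_pow, ← sigmaPow_add_one, add_smul,
      ← Module.End.mul_apply, ← pow_succ', mul_comm, mul_smul]
    have h1 : m + 1 - ((k + 1 : ℕ) : ℤ) = m - ((k + 1 : ℕ) : ℤ) + 1 := by ring
    have h2 : m + 1 - ((k + 1 : ℕ) : ℤ) = m - k := by push_cast; ring
    have h3 : N - (m + 1) + ((k + 1 : ℕ) : ℤ) = N - 1 - m + ((k + 1 : ℕ) : ℤ) := by ring
    have h4 : N - (m + 1) + ((k + 1 : ℕ) : ℤ) = N - m + k := by push_cast; ring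
    rw [← h1, ← h2, ← h3, ← h4]
  · have h3 : N - (m + 1) + ((0 : ℕ) : ℤ) = N - 1 - m + ((0 : ℕ) : ℤ) := by ring
    have h1 : m + 1 - ((0 : ℕ) : ℤ) = m - ((0 : ℕ) : ℤ) + 1 := by ring
    rw [superChoose_zero_right, superChoose_zero_right, h1, sigmaPow_add_one, h3]
    simp

theorem one_comp (B : SPDO 𝕜) : comp (monomial 0 1) B = B := by
  obtain ⟨b, hb⟩ := B.2
  refine Subtype.ext (funext fun N => ?_)
  obtain ⟨K, hK⟩ : ∃ K : ℕ, b - N < K := ⟨(b - N + 1).toNat, by omega⟩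
  rw [monomial_one_comp_coeff hb 0 N (K := K + 1) (by push_cast; omega), Finset.sum_range_succ',
    Finset.sum_eq_zero]
  · simp [superChoose_zero_right, sigmaPow]
  · intro k _
    obtain h | h := Nat.even_or_odd (k + 1)
    · obtain ⟨j, hj⟩ : ∃ j, (k + 1) / 2 = j + 1 := ⟨(k + 1) / 2 - 1, by
        obtain ⟨r, hr⟩ := h; omega⟩
      simp [superChoose, h, hj]
    · simp [superChoose, h]

theorem comp_add (A B C : SPDO 𝕜) : comp A (B + C) = comp A B + comp A C := by
  obtain ⟨a, ha⟩ := A.2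
  obtain ⟨b, hb⟩ := B.2
  obtain ⟨c, hc⟩ := C.2
  have hb' : ∀ k, max b c < k → B.1 k = 0 := fun k hk => hb k (by omega)
  have hc' : ∀ k, max b c < k → C.1 k = 0 := fun k hk => hc k (by omega)
  refine Subtype.ext (funext fun N => ?_)
  obtain ⟨K, hK⟩ : ∃ K : ℕ, max b c - N + a < K := ⟨(max b c - N + a + 1).toNat, by omega⟩
  rw [Submodule.coe_add, Pi.add_apply, comp_coeff ha hb' N le_rfl hK,
    comp_coeff ha hc' N le_rfl hK, comp_coeff (B := B + C) ha (fun k hk => by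
      rw [Submodule.coe_add, Pi.add_apply, hb' k hk, hc' k hk, add_zero]) N le_rfl hK]
  simp only [Submodule.coe_add, Pi.add_apply, sigmaPow_add, map_add, mul_add, smul_add,
    Finset.sum_add_distrib]

theorem add_comp (A B C : SPDO 𝕜) : comp (A + B) C = comp A C + comp B C := by
  obtain ⟨a, ha⟩ := A.2
  obtain ⟨b, hb⟩ := B.2
  obtain ⟨c, hc⟩ := C.2
  have ha' : ∀ k, max a b < k → A.1 k = 0 := fun k hk => ha k (by omega)
  have hb' : ∀ k, max a b < k → B.1 k = 0 := fun k hk => hb k (by omega)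
  refine Subtype.ext (funext fun N => ?_)
  rw [Submodule.coe_add, Pi.add_apply, comp_coeff_eq_sum ha' hc N le_rfl,
    comp_coeff_eq_sum hb' hc N le_rfl, comp_coeff_eq_sum (A := A + B) (fun k hk => by
      rw [Submodule.coe_add, Pi.add_apply, ha' k hk, hb' k hk, add_zero]) hc N le_rfl]
  simp only [Submodule.coe_add, Pi.add_apply, add_mul, Finset.sum_add_distrib]

theorem comp_smul (a : 𝕜) (A B : SPDO 𝕜) : comp A (a • B) = a • comp A B := by
  obtain ⟨p, hp⟩ := A.2
  obtain ⟨b, hb⟩ := B.2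
  refine Subtype.ext (funext fun N => ?_)
  obtain ⟨K, hK⟩ : ∃ K : ℕ, b - N + p < K := ⟨(b - N + p + 1).toNat, by omega⟩
  rw [Submodule.coe_smul, Pi.smul_apply, comp_coeff hp hb N le_rfl hK,
    comp_coeff (B := a • B) hp (fun k hk => by
      rw [Submodule.coe_smul, Pi.smul_apply, hb k hk, smul_zero]) N le_rfl hK]
  simp only [Submodule.coe_smul, Pi.smul_apply, sigmaPow_smul, map_smul, mul_smul_comm,
    Finset.smul_sum, smul_comm a]

theorem smul_comp (a : 𝕜) (A B : SPDO 𝕜) : comp (a • A) B = a • comp A B := by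
  obtain ⟨p, hp⟩ := A.2
  obtain ⟨b, hb⟩ := B.2
  refine Subtype.ext (funext fun N => ?_)
  rw [Submodule.coe_smul, Pi.smul_apply, comp_coeff_eq_sum hp hb N le_rfl,
    comp_coeff_eq_sum (A := a • A) (fun k hk => by
      rw [Submodule.coe_smul, Pi.smul_apply, hp k hk, smul_zero]) hb N le_rfl]
  simp only [Submodule.coe_smul, Pi.smul_apply, smul_mul_assoc, Finset.smul_sum]

/-- The case `η ∘ (A ∘ B) = (η ∘ A) ∘ B` of associativity, a consequence of the super Leibniz
rule. -/
theorem etaLeft_comp (A B : SPDO 𝕜) : etaLeft (comp A B) = comp (etaLeft A) B := by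
  obtain ⟨a, ha⟩ := A.2
  obtain ⟨b, hb⟩ := B.2
  refine Subtype.ext (funext fun N => ?_)
  have hE : ∀ k, a + 1 < k → (etaLeft A).1 k = 0 := fun k hk => by
    rw [etaLeft_coeff, ha k (by omega), ha (k - 1) (by omega), map_zero, map_zero, add_zero]
  have hA1 : ∀ k, a + 1 < k → A.1 k = 0 := fun k hk => ha k (by omega)
  have hA2 : ∀ k, a + 1 < k → A.1 (k - 1) = 0 := fun k hk => ha _ (by omega)
  rw [etaLeft_coeff, comp_coeff_eq_sum hE hb N (p := N - b) le_rfl,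
    comp_coeff_eq_sum ha hb (N - 1) (p := N - b - 1) (by omega),
    comp_coeff_eq_sum hA1 hb N (p := N - b) le_rfl, map_sum, map_sum]
  simp only [etaLeft_coeff, add_mul, Finset.sum_add_distrib, sigma_mul, eta_mul]
  have hshift : ∑ m ∈ Finset.Icc (N - b) (a + 1),
        sigma (A.1 (m - 1)) * (comp (monomial m 1) B).1 N =
      ∑ m ∈ Finset.Icc (N - b - 1) a,
        sigma (A.1 m) * (comp (monomial (m + 1) 1) B).1 N := by
    refine (Finset.sum_nbij' (fun m => m + 1) (fun m => m - 1) ?_ ?_ ?_ ?_ ?_).symm <;>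
      simp only [Finset.mem_Icc] <;> intros <;> first | omega | simp
  have hext : ∀ f : ℤ → SFun 𝕜, (∑ m ∈ Finset.Icc (N - b) (a + 1), sigma (A.1 m) * f m) =
      ∑ m ∈ Finset.Icc (N - b) a, sigma (A.1 m) * f m := by
    intro f
    refine (Finset.sum_subset (Finset.Icc_subset_Icc_right (by omega)) fun m hm hm' => ?_).symm
    rw [Finset.mem_Icc] at hm hm'
    rw [ha m (by omega), map_zero, zero_mul]
  have hlow : ∀ f : ℤ → SFun 𝕜, (∀ m, m < N - b → f m = 0) →
      (∑ m ∈ Finset.Icc (N - b) a, sigma (A.1 m) * f m) =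
      ∑ m ∈ Finset.Icc (N - b - 1) a, sigma (A.1 m) * f m := by
    intro f hf
    refine Finset.sum_subset (Finset.Icc_subset_Icc_left (by omega)) fun m hm hm' => ?_
    rw [Finset.mem_Icc] at hm hm'
    rw [hf m (by omega), mul_zero]
  rw [hshift, hext, hlow (fun m => eta ((comp (monomial m 1) B).1 N))
    fun m hm => by rw [monomial_one_comp_eq_zero hb m (by omega), map_zero]]
  simp only [monomial_add_one_comp, etaLeft_coeff, mul_add, Finset.sum_add_distrib]
  abel

/-- The case `η^m ∘ (A ∘ B) = (η^m ∘ A) ∘ B` of associativity. Negative `m` are reached because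
left composition with `η` is injective. -/
theorem monomial_one_comp_comp (m : ℤ) (A B : SPDO 𝕜) :
    comp (monomial m 1) (comp A B) = comp (comp (monomial m 1) A) B := by
  induction m using Int.induction_on with
  | zero => rw [one_comp, one_comp]
  | succ n ih => rw [monomial_add_one_comp, monomial_add_one_comp, ih, etaLeft_comp]
  | pred n ih =>
    have h := fun C : SPDO 𝕜 => monomial_add_one_comp (-(n : ℤ) - 1) C
    simp only [sub_add_cancel] at h
    refine etaLeft_injective ?_
    rw [← h, ih, h A, ← etaLeft_comp]

theorem comp_assoc (A B C : SPDO 𝕜) : comp (comp A B) C = comp A (comp B C) := by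
  obtain ⟨a, ha⟩ := A.2
  obtain ⟨b, hb⟩ := B.2
  obtain ⟨c, hc⟩ := C.2
  refine Subtype.ext (funext fun N => ?_)
  have hAB : ∀ k, a + b < k → (comp A B).1 k = 0 := fun k hk => comp_eq_zero ha hb hk
  have hBC : ∀ k, b + c < k → (comp B C).1 k = 0 := fun k hk => comp_eq_zero hb hc hk
  rw [comp_coeff_eq_sum hAB hc N le_rfl, comp_coeff_eq_sum ha hBC N le_rfl]
  have h1 : ∀ n ∈ Finset.Icc (N - c) (a + b), (comp A B).1 n * (comp (monomial n 1) C).1 N =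
      ∑ m ∈ Finset.Icc (N - (b + c)) a,
        A.1 m * (comp (monomial m 1) B).1 n * (comp (monomial n 1) C).1 N := by
    intro n hn
    have hn := (Finset.mem_Icc.1 hn).1
    rw [comp_coeff_eq_sum ha hb n (p := N - (b + c)) (by omega), Finset.sum_mul]
  rw [Finset.sum_congr rfl h1, Finset.sum_comm]
  refine Finset.sum_congr rfl fun m hm => ?_
  have hm := (Finset.mem_Icc.1 hm).2
  have hmB : ∀ k, a + b < k → (comp (monomial m 1) B).1 k = 0 :=
    fun k hk => monomial_one_comp_eq_zero hb m (by omega)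
  rw [monomial_one_comp_comp, comp_coeff_eq_sum hmB hc N le_rfl, Finset.mul_sum]
  exact Finset.sum_congr rfl fun n _ => mul_assoc _ _ _

/-! ### Operators given by two power series -/

open PowerSeries in
/-- The operator `∑ₙ (vₙ ∂ⁿ(F) - 2 uₙ ∂ⁿ(η(F)) θ) η^{2-2n} + ∑ₙ uₙ ∂ⁿ(η(F)) η^{1-2n}` attached to
a function `F` and to two formal power series `U = ∑ uₙ Xⁿ` and `V = ∑ vₙ Xⁿ`, where `∂ = ∂/∂x`.
The embedding `ρ` and the three cocycles are all of this form; since `η̄ = η - 2θη²`, the two terms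
with the same `uₙ` make up `uₙ ∂ⁿ(η(F)) η̄ η^{-2n}`. -/
noncomputable def stdOp (U V : PowerSeries 𝕜) (F : SFun 𝕜) : SPDO 𝕜 :=
  ⟨fun k => if 2 < k then 0 else
    if Even k then
      coeff ((2 - k) / 2).toNat V • (dx ^ ((2 - k) / 2).toNat) F -
        (2 * coeff ((2 - k) / 2).toNat U) • ((dx ^ ((2 - k) / 2).toNat) (eta F) * theta)
    else coeff ((1 - k) / 2).toNat U • (dx ^ ((1 - k) / 2).toNat) (eta F),
    2, fun k hk => by simp [hk]⟩

variable (U V U' V' : PowerSeries 𝕜) (F G : SFun 𝕜)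

theorem stdOp_eq_zero {k : ℤ} (hk : 2 < k) : (stdOp U V F).1 k = 0 := if_pos hk

theorem stdOp_even (n : ℕ) : (stdOp U V F).1 (2 - 2 * n) =
    U.coeff n • (-2 : 𝕜) • ((dx ^ n) (eta F) * theta) + V.coeff n • (dx ^ n) F := by
  have h1 : ¬ (2 : ℤ) < 2 - 2 * n := by omega
  have h2 : ((2 - (2 - 2 * (n : ℤ))) / 2).toNat = n := by omega
  have h3 : Even (2 - 2 * (n : ℤ)) := by simp [parity_simps]
  simp only [stdOp, if_neg h1, if_pos h3, h2]
  module

theorem stdOp_odd (n : ℕ) : (stdOp U V F).1 (1 - 2 * n) = U.coeff n • (dx ^ n) (eta F) := by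
  have h1 : ¬ (2 : ℤ) < 1 - 2 * n := by omega
  have h2 : ((1 - (1 - 2 * (n : ℤ))) / 2).toNat = n := by omega
  have h3 : ¬ Even (1 - 2 * (n : ℤ)) := by simp [parity_simps]
  simp only [stdOp, if_neg h1, if_neg h3, h2]

/-- Two operators agree if they agree above degree `2` and in all degrees `2 - 2n`, `1 - 2n`. -/
theorem SPDO.ext_std {A B : SPDO 𝕜} (h : ∀ k, 2 < k → A.1 k = B.1 k)
    (he : ∀ n : ℕ, A.1 (2 - 2 * n) = B.1 (2 - 2 * n))
    (ho : ∀ n : ℕ, A.1 (1 - 2 * n) = B.1 (1 - 2 * n)) : A = B := by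
  refine Subtype.ext (funext fun k => ?_)
  by_cases hk : 2 < k
  · exact h k hk
  obtain ⟨l, rfl | rfl⟩ := Int.even_or_odd' k
  · have := he (1 - l).toNat
    have h1 : 2 - 2 * ((1 - l).toNat : ℤ) = 2 * l := by omega
    rwa [h1] at this
  · have := ho (-l).toNat
    have h1 : 1 - 2 * ((-l).toNat : ℤ) = 2 * l + 1 := by omega
    rwa [h1] at this

theorem stdOp_add_series :
    stdOp (U + U') (V + V') F = stdOp U V F + stdOp U' V' F := by
  refine SPDO.ext_std (fun k hk => ?_) (fun n => ?_) fun n => ?_ <;>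
    rw [Submodule.coe_add, Pi.add_apply]
  · simp [stdOp_eq_zero _ _ _ hk]
  · simp only [stdOp_even, map_add]; module
  · simp only [stdOp_odd, map_add]; module

theorem stdOp_smul_series (c : 𝕜) : stdOp (c • U) (c • V) F = c • stdOp U V F := by
  refine SPDO.ext_std (fun k hk => ?_) (fun n => ?_) fun n => ?_ <;>
    rw [Submodule.coe_smul, Pi.smul_apply]
  · simp [stdOp_eq_zero _ _ _ hk]
  · simp only [stdOp_even, map_smul, smul_eq_mul]; module
  · simp only [stdOp_odd, map_smul, smul_eq_mul]; module

theorem stdOp_isLinearMap : IsLinearMap 𝕜 (stdOp U V) where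
  map_add F G := by
    refine SPDO.ext_std (fun k hk => ?_) (fun n => ?_) fun n => ?_ <;>
      rw [Submodule.coe_add, Pi.add_apply]
    · simp [stdOp_eq_zero _ _ _ hk]
    · simp only [stdOp_even, map_add, add_mul]; module
    · simp only [stdOp_odd, map_add]; module
  map_smul c F := by
    refine SPDO.ext_std (fun k hk => ?_) (fun n => ?_) fun n => ?_ <;>
      rw [Submodule.coe_smul, Pi.smul_apply]
    · simp [stdOp_eq_zero _ _ _ hk]
    · simp only [stdOp_even, map_smul, smul_mul_assoc]; module
    · simp only [stdOp_odd, map_smul]; module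

theorem fst_dx_pow (n : ℕ) : ((dx ^ n) F).fst = (circleDeriv ^ n) F.fst := by
  induction n with
  | zero => rfl
  | succ n ih => rw [pow_succ', pow_succ', Module.End.mul_apply, fst_dx, ih]; rfl

theorem snd_dx_pow (n : ℕ) : ((dx ^ n) F).snd = (circleDeriv ^ n) F.snd := by
  induction n with
  | zero => rfl
  | succ n ih => rw [pow_succ', pow_succ', Module.End.mul_apply, snd_dx, ih]; rfl

theorem stdOp_even_fst (n : ℕ) : ((stdOp U V F).1 (2 - 2 * n)).fst =
    V.coeff n • (circleDeriv ^ n) F.fst := by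
  simp [stdOp_even, fst_dx_pow, fst_theta]

theorem stdOp_even_snd (n : ℕ) : ((stdOp U V F).1 (2 - 2 * n)).snd =
    (V.coeff n - 2 * U.coeff n) • (circleDeriv ^ n) F.snd := by
  simp [stdOp_even, fst_dx_pow, snd_dx_pow, fst_theta, snd_theta, fst_eta]
  module

theorem stdOp_odd_fst (n : ℕ) : ((stdOp U V F).1 (1 - 2 * n)).fst =
    U.coeff n • (circleDeriv ^ n) F.snd := by
  simp [stdOp_odd, fst_dx_pow, fst_eta]

theorem stdOp_odd_snd (n : ℕ) : ((stdOp U V F).1 (1 - 2 * n)).snd =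
    U.coeff n • (circleDeriv ^ (n + 1)) F.fst := by
  simp [stdOp_odd, snd_dx_pow, snd_eta, pow_succ]

theorem superPart_zero (i : Fin 2) : superPart i (0 : SFun 𝕜) = 0 := by
  ext <;> simp [fst_superPart, snd_superPart]

theorem stdOp_superPart (i : Fin 2) : stdOp U V (superPart i F) = opPart i (stdOp U V F) := by
  refine SPDO.ext_std (fun k hk => ?_) (fun n => ?_) fun n => ?_
  · simp [opPart, stdOp_eq_zero _ _ _ hk, superPart_zero]
  · have h3 : Even (2 - 2 * (n : ℤ)) := by simp [parity_simps]
    simp only [opPart, if_pos h3]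
    ext <;> simp only [stdOp_even_fst, stdOp_even_snd, fst_superPart, snd_superPart] <;>
      split_ifs <;> simp
  · have h3 : ¬ Even (1 - 2 * (n : ℤ)) := by simp [parity_simps]
    simp only [opPart, if_neg h3]
    ext <;> simp only [stdOp_odd_fst, stdOp_odd_snd, fst_superPart, snd_superPart] <;>
      fin_cases i <;> simp

theorem rho_eq_stdOp : rho F = stdOp (PowerSeries.C (2⁻¹ : 𝕜)) 1 F := by
  have h0 : ∀ k, k ≠ 2 → k ≠ 1 → (rho F).1 k = 0 := by
    intro k h2 h1
    simp [rho, leftMul, etaBarPow, monomial_of_ne h2, monomial_of_ne h1]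
  have h2 : (rho F).1 2 = F - eta F * theta := by
    simp [rho, leftMul, etaBarPow, monomial_same, monomial_of_ne (show (2 : ℤ) ≠ 1 by simp)]
    abel
  have h1 : (rho F).1 1 = (2⁻¹ : 𝕜) • eta F := by
    simp [rho, leftMul, etaBarPow, monomial_same, monomial_of_ne (show (1 : ℤ) ≠ 2 by simp)]
  refine SPDO.ext_std (fun k hk => ?_) (fun n => ?_) fun n => ?_
  · rw [h0 k (by omega) (by omega), stdOp_eq_zero _ _ _ hk]
  · rw [stdOp_even]
    cases n with
    | zero => simp [h2]; abel
    | succ n => rw [h0 _ (by omega) (by omega)]; simp [PowerSeries.coeff_one]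
  · rw [stdOp_odd]
    cases n with
    | zero => simp [h1]
    | succ n => rw [h0 _ (by omega) (by omega)]; simp

theorem Theta1_eq_stdOp : Theta1 F = stdOp 0 PowerSeries.X F := by
  refine SPDO.ext_std (fun k hk => ?_) (fun n => ?_) fun n => ?_
  · rw [Theta1, monomial_of_ne (by omega), stdOp_eq_zero _ _ _ hk]
  · rw [stdOp_even, Theta1, PowerSeries.coeff_X]
    split_ifs with h
    · subst h
      simp [monomial_same, pow_two, eta_eta]
    · rw [monomial_of_ne (by omega)]; simp
  · rw [stdOp_odd, Theta1, monomial_of_ne (by omega)]; simp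

theorem etaBar_pow_two_mul (n : ℕ) : (etaBar ^ (2 * n)) F = (-1 : 𝕜) ^ n • (dx ^ n) F := by
  have h : ∀ G : SFun 𝕜, etaBar (etaBar G) = -dx G := fun G => by
    ext <;> simp [fst_etaBar, snd_etaBar, fst_dx, snd_dx]
  induction n with
  | zero => simp
  | succ n ih =>
    rw [mul_add, mul_one, pow_succ', pow_succ', Module.End.mul_apply, Module.End.mul_apply, h, ih,
      pow_succ' dx, Module.End.mul_apply, map_smul, pow_succ]
    module

theorem sigma_etaBar_pow (n : ℕ) :
    sigma ((etaBar ^ (2 * n + 1)) F) = (-1 : 𝕜) ^ n • (dx ^ n) (eta F) := by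
  rw [pow_succ, Module.End.mul_apply, etaBar_pow_two_mul, map_smul]
  congr 1
  ext <;> simp [fst_sigma, snd_sigma, fst_dx_pow, snd_dx_pow, fst_etaBar, snd_etaBar, fst_eta,
    snd_eta]

theorem cocycleTerm_eq_stdOp (a b : 𝕜) (n : ℕ) : cocycleTerm a b n F =
    stdOp (PowerSeries.monomial n ((-1) ^ n * a))
      (PowerSeries.monomial (n + 1) ((-1) ^ (n + 1) * b)) F := by
  have e1 : ¬ Even (-2 * (n : ℤ) + 1) := by simp [parity_simps]
  have e2 : Even (-2 * (n : ℤ)) := by simp [parity_simps]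
  have e3 : (-2 * (n : ℤ) + 1) / 2 = -n := by omega
  have e4 : (-2 * (n : ℤ)) / 2 = -n := by omega
  have e5 : ((-(n : ℤ)).negOnePow : ℤ) = (-1) ^ n := by
    rw [Int.negOnePow_neg, Int.negOnePow_def, zpow_natCast]; simp
  have e6 : (-1 : 𝕜) ^ n * (-1) ^ n = 1 := by rw [← mul_pow]; simp
  have hc : ∀ k, (cocycleTerm a b n F).1 k = (-1 : 𝕜) ^ n •
      (a • ((dx ^ n) (eta F) * ((monomial (-2 * (n : ℤ) + 1) 1).1 k -
        (2 : 𝕜) • (monomial (-2 * (n : ℤ) + 1 + 1) theta).1 k)) -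
        b • ((dx ^ (n + 1)) F * (monomial (-2 * (n : ℤ)) 1).1 k)) := by
    intro k
    have h1 : ∀ (m : ℤ) (A : SPDO 𝕜), ((m • A : SPDO 𝕜) : ℤ → SFun 𝕜) k = (m : 𝕜) • A.1 k := by
      intro m A
      rw [Int.cast_smul_eq_zsmul]; rfl
    have h3 : 2 * n + 2 = 2 * (n + 1) := by ring
    unfold cocycleTerm etaBarPow
    rw [if_neg e1, if_pos e2, e3, e4, e5, sigma_etaBar_pow, h3, etaBar_pow_two_mul]
    simp only [Submodule.coe_smul, Submodule.coe_add, Pi.smul_apply, Pi.add_apply, leftMul, h1,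
      Submodule.coe_sub, Pi.sub_apply, smul_mul_assoc, mul_smul_comm, smul_smul]
    push_cast
    rw [pow_succ, show (-1 : 𝕜) ^ n * -1 * (-1) ^ n = -1 by linear_combination -e6, e6]
    module
  refine SPDO.ext_std (fun k hk => ?_) (fun m => ?_) fun m => ?_
  · rw [cocycleTerm_eq_zero a b n F k (by omega), stdOp_eq_zero _ _ _ hk]
  · rw [hc, stdOp_even, PowerSeries.coeff_monomial, PowerSeries.coeff_monomial,
      monomial_of_ne (by omega)]
    by_cases h1 : m = n
    · subst h1
      have h2 : (2 : ℤ) - 2 * m = -2 * (m : ℤ) + 1 + 1 := by ring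
      rw [monomial_of_ne (m := -2 * (m : ℤ)) (by omega), h2, monomial_same]
      simp [-neg_mul]
      module
    · rw [monomial_of_ne (m := -2 * (n : ℤ) + 1 + 1) (by omega), if_neg h1]
      by_cases h2 : m = n + 1
      · subst h2
        have h2 : (2 : ℤ) - 2 * ((n + 1 : ℕ) : ℤ) = -2 * (n : ℤ) := by push_cast; ring
        rw [h2, monomial_same, if_pos rfl, pow_succ (-1 : 𝕜)]
        simp [-neg_mul]
        module
      · rw [if_neg h2, monomial_of_ne (by omega)]
        simp
  · rw [hc, stdOp_odd, PowerSeries.coeff_monomial, monomial_of_ne (m := -2 * (n : ℤ) + 1 + 1)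
      (by omega), monomial_of_ne (m := -2 * (n : ℤ)) (by omega)]
    by_cases h1 : m = n
    · subst h1
      have h2 : (1 : ℤ) - 2 * m = -2 * (m : ℤ) + 1 := by ring
      rw [if_pos rfl, h2, monomial_same]
      simp [-neg_mul]
      module
    · rw [monomial_of_ne (by omega), if_neg h1]
      simp

theorem cocycleSeries_eq_stdOp (a b : ℕ → 𝕜) : cocycleSeries a b F =
    stdOp (PowerSeries.mk fun n => if n = 0 then 0 else (-1) ^ n * a n)
      (PowerSeries.mk fun n => if n ≤ 1 then 0 else (-1) ^ n * b (n - 1)) F := by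
  refine SPDO.ext_std (fun k hk => ?_) (fun m => ?_) fun m => ?_
  · rw [stdOp_eq_zero _ _ _ hk]
    have : (2 - k).toNat = 0 := by omega
    simp [cocycleSeries, this]
  · have h2 : (2 - (2 - 2 * (m : ℤ))).toNat = 2 * m := by omega
    simp only [cocycleSeries, h2, cocycleTerm_eq_stdOp, stdOp_even, Finset.sum_add_distrib,
      ← Finset.sum_smul, PowerSeries.coeff_mk, PowerSeries.coeff_monomial]
    congr 2
    · rw [Finset.sum_ite_eq]
      by_cases h : m = 0
      · simp [h]
      · rw [if_neg h, if_pos (Finset.mem_Icc.2 (by omega))]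
    · by_cases h : m ≤ 1
      · rw [if_pos h]
        refine Finset.sum_eq_zero fun n hn => if_neg ?_
        have := (Finset.mem_Icc.1 hn).1
        omega
      · obtain ⟨r, rfl⟩ : ∃ r, m = r + 1 := ⟨m - 1, by omega⟩
        simp only [add_left_inj]
        rw [Finset.sum_ite_eq, if_neg h, if_pos (Finset.mem_Icc.2 (by omega)),
          add_tsub_cancel_right]
  · have h2 : (2 - (1 - 2 * (m : ℤ))).toNat = 2 * m + 1 := by omega
    simp only [cocycleSeries, h2, cocycleTerm_eq_stdOp, stdOp_odd,
      ← Finset.sum_smul, PowerSeries.coeff_mk, PowerSeries.coeff_monomial]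
    congr 1
    rw [Finset.sum_ite_eq]
    by_cases h : m = 0
    · simp [h]
    · rw [if_neg h, if_pos (Finset.mem_Icc.2 (by omega))]

/-! ### Powers of `η` -/

theorem eta_one : eta (1 : SFun 𝕜) = 0 := by
  ext <;> simp [fst_eta, snd_eta, circleDeriv_one]

theorem sigma_one : sigma (1 : SFun 𝕜) = 1 := by
  ext <;> simp [fst_sigma, snd_sigma]

theorem etaLeft_monomial_one (k : ℤ) : etaLeft (monomial k (1 : SFun 𝕜)) = monomial (k + 1) 1 := by
  refine Subtype.ext (funext fun N => ?_)
  rw [etaLeft_coeff]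
  by_cases h1 : N = k + 1
  · subst h1
    rw [add_sub_cancel_right, monomial_same, monomial_same, monomial_of_ne (by omega), sigma_one,
      map_zero, add_zero]
  · rw [monomial_of_ne (by omega), monomial_of_ne h1, map_zero, zero_add]
    by_cases h2 : N = k
    · rw [h2, monomial_same, eta_one]
    · rw [monomial_of_ne h2, map_zero]

theorem monomial_one_comp_monomial_one (m n : ℤ) :
    comp (monomial m 1) (monomial n 1) = monomial (m + n) (1 : SFun 𝕜) := by
  induction m using Int.induction_on with
  | zero => rw [one_comp, zero_add]
  | succ m ih => rw [monomial_add_one_comp, ih, etaLeft_monomial_one, add_right_comm]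
  | pred m ih =>
    have h := monomial_add_one_comp (-(m : ℤ) - 1) (monomial n (1 : SFun 𝕜))
    rw [sub_add_cancel, ih] at h
    refine etaLeft_injective ?_
    rw [← h, etaLeft_monomial_one]
    congr 1
    ring

theorem comp_monomial_one (A : SPDO 𝕜) (n N : ℤ) : (comp A (monomial n 1)).1 N = A.1 (N - n) := by
  obtain ⟨a, ha⟩ := A.2
  rw [comp_coeff_eq_sum ha (fun k hk => monomial_of_ne hk.ne' 1) N le_rfl]
  simp only [monomial_one_comp_monomial_one]
  by_cases h : N - n ≤ a
  · rw [Finset.sum_eq_single (N - n), sub_add_cancel, monomial_same, mul_one]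
    · intro m _ hm
      rw [monomial_of_ne (by omega), mul_zero]
    · intro hm
      exact absurd (Finset.mem_Icc.2 ⟨le_rfl, h⟩) hm
  · rw [ha _ (not_le.1 h), Finset.Icc_eq_empty h, Finset.sum_empty]

theorem monomial_one_one_comp (B : SPDO 𝕜) : comp (monomial 1 1) B = etaLeft B := by
  have h := monomial_add_one_comp 0 B
  rwa [one_comp, zero_add] at h

/-- Composition with `η² = ∂/∂x` on the left. -/
theorem monomial_two_one_comp_coeff (B : SPDO 𝕜) (N : ℤ) :
    (comp (monomial 2 1) B).1 N = B.1 (N - 2) + dx (B.1 N) := by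
  have h : (2 : ℤ) = 1 + 1 := rfl
  rw [h, monomial_add_one_comp, monomial_one_one_comp, ← h, etaLeft_coeff, etaLeft_coeff,
    etaLeft_coeff, map_add, map_add, sigma_sigma, eta_eta, eta_sigma, sub_sub, ← h]
  abel

/-- Composition with an operator that only involves `1`, `η` and `η²`. -/
theorem comp_coeff_of_support {A : SPDO 𝕜} (h : ∀ k, k ≠ 0 → k ≠ 1 → k ≠ 2 → A.1 k = 0)
    (B : SPDO 𝕜) (N : ℤ) : (comp A B).1 N = A.1 0 * B.1 N +
      A.1 1 * (sigma (B.1 (N - 1)) + eta (B.1 N)) + A.1 2 * (B.1 (N - 2) + dx (B.1 N)) := by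
  obtain ⟨b, hb⟩ := B.2
  rw [comp_coeff_eq_sum (q := 2) (fun k hk => h k (by omega) (by omega) (by omega)) hb N
    (min_le_left (N - b) 0), ← monomial_two_one_comp_coeff, ← etaLeft_coeff,
    ← monomial_one_one_comp]
  conv_rhs => rw [← one_comp B, ← comp_assoc, ← comp_assoc, monomial_one_comp_monomial_one,
    monomial_one_comp_monomial_one]
  have hs : ({0, 1, 2} : Finset ℤ) ⊆ Finset.Icc (min (N - b) 0) 2 := by
    intro m hm
    simp only [Finset.mem_insert, Finset.mem_singleton] at hm
    exact Finset.mem_Icc.2 (by omega)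
  rw [← Finset.sum_subset hs fun m _ hm => ?_]
  · simp [add_assoc]
  · simp only [Finset.mem_insert, Finset.mem_singleton, not_or] at hm
    rw [h m hm.1 hm.2.1 hm.2.2, zero_mul]

/-! ### Homomorphisms and intertwining operators -/

/-- `φ` sends the bracket of homogeneous elements to the supercommutator. -/
def PreservesBracket (φ : SFun 𝕜 → SPDO 𝕜) : Prop :=
  ∀ (i j : Fin 2) (F G : SFun 𝕜), φ (contactBracket (superPart i F) (superPart j G)) =
    comp (φ (superPart i F)) (φ (superPart j G)) -
      (-1 : 𝕜) ^ ((i : ℕ) * (j : ℕ)) • comp (φ (superPart j G)) (φ (superPart i F))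

theorem superPart_add_superPart (F : SFun 𝕜) : superPart 0 F + superPart 1 F = F := by
  ext <;> simp [fst_superPart, snd_superPart]

theorem contactBracket_add_left (F F' G : SFun 𝕜) :
    contactBracket (F + F') G = contactBracket F G + contactBracket F' G := by
  simp only [contactBracket, map_add, add_mul, smul_add]; abel

theorem contactBracket_add_right (F G G' : SFun 𝕜) :
    contactBracket F (G + G') = contactBracket F G + contactBracket F G' := by
  simp only [contactBracket, map_add, mul_add, smul_add]; abel

theorem IsSuperLieHom.of_preservesBracket {φ : SFun 𝕜 → SPDO 𝕜} (hl : IsLinearMap 𝕜 φ)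
    (he : ∀ (i : Fin 2) (F : SFun 𝕜), φ (superPart i F) = opPart i (φ F))
    (h : PreservesBracket φ) : IsSuperLieHom φ where
  isLinear := hl
  even := he
  map_bracket F G := by
    conv_lhs => rw [← superPart_add_superPart F, ← superPart_add_superPart G,
      contactBracket_add_left, contactBracket_add_right, contactBracket_add_right]
    simp only [hl.map_add, h _ _ _ _, superBracket, Fin.sum_univ_two, he]

theorem comp_sub (A B C : SPDO 𝕜) : comp A (B - C) = comp A B - comp A C := by
  rw [sub_eq_add_neg, sub_eq_add_neg, comp_add, ← neg_one_smul 𝕜 C, comp_smul,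
    neg_one_smul 𝕜 (comp A C)]

theorem sub_comp (A B C : SPDO 𝕜) : comp (A - B) C = comp A C - comp B C := by
  rw [sub_eq_add_neg, sub_eq_add_neg, add_comp, ← neg_one_smul 𝕜 B, smul_comp,
    neg_one_smul 𝕜 (comp B C)]

/-- If `ψ(F) ∘ Q = Q ∘ φ(F)`, where `Q` may be cancelled on the right, then `ψ` preserves brackets
whenever `φ` does. -/
theorem PreservesBracket.of_comp_right {φ ψ : SFun 𝕜 → SPDO 𝕜} (h : PreservesBracket φ)
    (Q : SPDO 𝕜) (hQ : ∀ A B, comp A Q = comp B Q → A = B)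
    (hψ : ∀ F, comp (ψ F) Q = comp Q (φ F)) : PreservesBracket ψ := by
  have key : ∀ F G, comp (comp (ψ F) (ψ G)) Q = comp Q (comp (φ F) (φ G)) := fun F G => by
    rw [comp_assoc, hψ, ← comp_assoc, hψ, comp_assoc]
  intro i j F G
  refine hQ _ _ ?_
  rw [hψ, h, sub_comp, comp_sub, smul_comp, comp_smul, key, key]

/-- If `Q ∘ ψ(F) = φ(σ(F)) ∘ Q`, where `Q` may be cancelled on the left, then `ψ` preserves
brackets whenever `φ` does. The twist by `σ` is the sign rule for an odd `Q`. -/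
theorem PreservesBracket.of_comp_left {φ ψ : SFun 𝕜 → SPDO 𝕜} (h : PreservesBracket φ)
    (Q : SPDO 𝕜) (hQ : ∀ A B, comp Q A = comp Q B → A = B)
    (hψ : ∀ F, comp Q (ψ F) = comp (φ (sigma F)) Q) : PreservesBracket ψ := by
  have key : ∀ F G, comp Q (comp (ψ F) (ψ G)) = comp (comp (φ (sigma F)) (φ (sigma G))) Q :=
    fun F G => by rw [← comp_assoc, hψ, comp_assoc, hψ, comp_assoc]
  have hs : ∀ F G : SFun 𝕜, sigma (contactBracket F G) = contactBracket (sigma F) (sigma G) := by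
    intro F G
    ext <;> simp [fst_sigma, snd_sigma, fst_contactBracket, snd_contactBracket]
    module
  have hp : ∀ (i : Fin 2) (F : SFun 𝕜), sigma (superPart i F) = superPart i (sigma F) := by
    intro i F
    ext <;> simp only [fst_sigma, snd_sigma, fst_superPart, snd_superPart]
    all_goals split_ifs
    all_goals simp
  intro i j F G
  refine hQ _ _ ?_
  rw [hψ, hs, hp, hp, h, sub_comp, comp_sub, smul_comp, comp_smul, key, key, hp, hp]

theorem comp_monomial_one_cancel (n : ℤ) (A B : SPDO 𝕜)
    (h : comp A (monomial n 1) = comp B (monomial n 1)) : A = B := by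
  refine Subtype.ext (funext fun k => ?_)
  have := congrArg (fun C : SPDO 𝕜 => C.1 (k + n)) h
  simpa [comp_monomial_one] using this

open PowerSeries in
/-- Conjugation by `η² = ∂/∂x` multiplies both series by `1 + X`. -/
theorem stdOp_one_add_X_comp (U V : PowerSeries 𝕜) (F : SFun 𝕜) :
    comp (stdOp ((1 + X) * U) ((1 + X) * V) F) (monomial 2 1) =
      comp (monomial 2 1) (stdOp U V F) := by
  have hdθ : dx (theta : SFun 𝕜) = 0 := by
    ext <;> simp [fst_dx, snd_dx, fst_theta, snd_theta, circleDeriv_one]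
  have hdmul : ∀ G : SFun 𝕜, dx (G * theta) = dx G * theta := by
    intro G
    ext <;> simp [fst_dx, snd_dx, fst_theta, snd_theta]
  refine Subtype.ext (funext fun k => ?_)
  rw [comp_monomial_one, monomial_two_one_comp_coeff]
  by_cases hk : 4 < k
  · rw [stdOp_eq_zero _ _ _ (by omega), stdOp_eq_zero _ _ _ (by omega),
      stdOp_eq_zero _ _ _ (by omega), map_zero, add_zero]
  obtain ⟨l, rfl | rfl⟩ := Int.even_or_odd' k
  · obtain ⟨n, rfl⟩ : ∃ n : ℕ, l = 2 - n := ⟨(2 - l).toNat, by omega⟩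
    have h1 : 2 * (2 - (n : ℤ)) - 2 = 2 - 2 * n := by ring
    rw [h1, stdOp_even, stdOp_even]
    cases n with
    | zero => rw [stdOp_eq_zero _ _ _ (by simp)]; simp
    | succ n =>
      have h2 : 2 * (2 - ((n + 1 : ℕ) : ℤ)) = 2 - 2 * n := by push_cast; ring
      rw [h2, stdOp_even]
      simp only [add_mul, one_mul, map_add, coeff_succ_X_mul, map_smul, hdmul, pow_succ' dx,
        Module.End.mul_apply]
      module
  · obtain ⟨n, rfl⟩ : ∃ n : ℕ, l = 1 - n := ⟨(1 - l).toNat, by omega⟩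
    have h1 : 2 * (1 - (n : ℤ)) + 1 - 2 = 1 - 2 * n := by ring
    rw [h1, stdOp_odd, stdOp_odd]
    cases n with
    | zero => rw [stdOp_eq_zero _ _ _ (by simp)]; simp
    | succ n =>
      have h2 : 2 * (1 - ((n + 1 : ℕ) : ℤ)) + 1 = 1 - 2 * n := by push_cast; ring
      rw [h2, stdOp_odd]
      simp only [add_mul, one_mul, map_add, coeff_succ_X_mul, map_smul, pow_succ' dx,
        Module.End.mul_apply]
      module

theorem PreservesBracket.one_add_X_mul {U V : PowerSeries 𝕜} (h : PreservesBracket (stdOp U V)) :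
    PreservesBracket (stdOp ((1 + PowerSeries.X) * U) ((1 + PowerSeries.X) * V)) :=
  h.of_comp_right (monomial 2 1) (comp_monomial_one_cancel 2) (stdOp_one_add_X_comp U V)

/-! ### Densities -/

/-- The action `ρ(v_F) + l F'` of `v_F` on densities of weight `l`. -/
noncomputable def densityOp (l : 𝕜) : SFun 𝕜 → SPDO 𝕜 :=
  stdOp (PowerSeries.C (2⁻¹ : 𝕜)) (1 + PowerSeries.C l * PowerSeries.X)

variable (l : 𝕜) (F : SFun 𝕜)

theorem densityOp_support (k : ℤ) (h0 : k ≠ 0) (h1 : k ≠ 1) (h2 : k ≠ 2) :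
    (densityOp l F).1 k = 0 := by
  by_cases hk : 2 < k
  · exact stdOp_eq_zero _ _ _ hk
  obtain ⟨j, rfl | rfl⟩ := Int.even_or_odd' k
  · obtain ⟨n, rfl⟩ : ∃ n : ℕ, j = 1 - (n + 2) := ⟨(-1 - j).toNat, by omega⟩
    have : 2 * (1 - ((n : ℤ) + 2)) = 2 - 2 * ((n + 2 : ℕ) : ℤ) := by push_cast; ring
    rw [densityOp, this, stdOp_even]
    simp [PowerSeries.coeff_one]
  · obtain ⟨n, rfl⟩ : ∃ n : ℕ, j = -(n + 1) := ⟨(-1 - j).toNat, by omega⟩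
    have : 2 * (-((n : ℤ) + 1)) + 1 = 1 - 2 * ((n + 1 : ℕ) : ℤ) := by push_cast; ring
    rw [densityOp, this, stdOp_odd]
    simp

theorem densityOp_two : (densityOp l F).1 2 = F - eta F * theta := by
  have := stdOp_even (PowerSeries.C (2⁻¹ : 𝕜)) (1 + PowerSeries.C l * PowerSeries.X) F 0
  simp at this
  rw [densityOp, this]; abel

theorem densityOp_one : (densityOp l F).1 1 = (2⁻¹ : 𝕜) • eta F := by
  have := stdOp_odd (PowerSeries.C (2⁻¹ : 𝕜)) (1 + PowerSeries.C l * PowerSeries.X) F 0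
  simp at this
  rw [densityOp, this]

theorem densityOp_zero : (densityOp l F).1 0 = l • dx F := by
  have := stdOp_even (PowerSeries.C (2⁻¹ : 𝕜)) (1 + PowerSeries.C l * PowerSeries.X) F 1
  simp [PowerSeries.coeff_one] at this
  rw [densityOp, this]

/-- Densities of weight `l` form a representation, which is a finite computation in degrees
`0, …, 4`. Halves and the weight are turned into elements `k` and `m` of the ring of functions, so
that each identity is one of commutative rings, up to `2k = 1`. -/
theorem preservesBracket_densityOp : PreservesBracket (densityOp l) := by
  intro i j F G
  have hi : i = 0 ∨ i = 1 := by omega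
  have hj : j = 0 ∨ j = 1 := by omega
  obtain ⟨k, hk, hs⟩ : ∃ k : CircleFun 𝕜, 2 * k = 1 ∧
      ∀ a : CircleFun 𝕜, (2⁻¹ : 𝕜) • a = k * a := by
    refine ⟨(2⁻¹ : 𝕜) • 1, ?_, fun a => by rw [smul_mul_assoc, one_mul]⟩
    rw [two_mul, ← add_smul, ← two_mul, mul_inv_cancel₀ two_ne_zero, one_smul]
  have hd : ∀ a : CircleFun 𝕜, circleDeriv (k * a) = k * circleDeriv a := fun a => by
    rw [← hs, map_smul, hs]
  obtain ⟨m, hm⟩ : ∃ m : CircleFun 𝕜, ∀ a : CircleFun 𝕜, l • a = m * a :=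
    ⟨l • 1, fun a => by rw [smul_mul_assoc, one_mul]⟩
  have hdm : ∀ a : CircleFun 𝕜, circleDeriv (m * a) = m * circleDeriv a := fun a => by
    rw [← hm, map_smul, hm]
  refine Subtype.ext (funext fun N => ?_)
  rw [Submodule.coe_sub, Pi.sub_apply, Submodule.coe_smul, Pi.smul_apply,
    comp_coeff_of_support (densityOp_support l _), comp_coeff_of_support (densityOp_support l _)]
  have hN : N = 0 ∨ N = 1 ∨ N = 2 ∨ N = 3 ∨ N = 4 ∨ (N ≠ 0 ∧ N ≠ 1 ∧ N ≠ 2 ∧ N ≠ 3 ∧ N ≠ 4) := by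
    omega
  have z1 := fun H => densityOp_support l H (-1) (by decide) (by decide) (by decide)
  have z2 := fun H => densityOp_support l H (-2) (by decide) (by decide) (by decide)
  have z3 := fun H => densityOp_support l H 3 (by decide) (by decide) (by decide)
  have z4 := fun H => densityOp_support l H 4 (by decide) (by decide) (by decide)
  rcases hN with rfl | rfl | rfl | rfl | rfl | ⟨h0, h1, h2, h3, h4⟩
  case inr.inr.inr.inr.inr =>
    have z : ∀ H, (densityOp l H).1 N = 0 := fun H => densityOp_support l H N h0 h1 h2
    have z' : ∀ H, (densityOp l H).1 (N - 1) = 0 := fun H =>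
      densityOp_support l H (N - 1) (by omega) (by omega) (by omega)
    have z'' : ∀ H, (densityOp l H).1 (N - 2) = 0 := fun H =>
      densityOp_support l H (N - 2) (by omega) (by omega) (by omega)
    simp [z, z', z'']
  all_goals
    norm_num only
    simp only [z1, z2, z3, z4, densityOp_two, densityOp_one, densityOp_zero]
    rcases hi with rfl | rfl <;> rcases hj with rfl | rfl <;>
    apply TrivSqZeroExt.ext <;>
    simp only [fst_contactBracket,
      snd_contactBracket, fst_superPart, snd_superPart, hs, map_add, map_sub, hd, circleDeriv_mul,
      map_neg,
      if_true, one_ne_zero, if_false, map_zero, Fin.val_zero, Fin.val_one, mul_zero, zero_mul,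
      pow_zero, pow_one, one_smul, neg_smul, mul_one, hm, hdm,
      TrivSqZeroExt.fst_add, TrivSqZeroExt.snd_add, TrivSqZeroExt.fst_mul, TrivSqZeroExt.snd_mul,
      TrivSqZeroExt.fst_sub, TrivSqZeroExt.snd_sub, TrivSqZeroExt.fst_smul, TrivSqZeroExt.snd_smul,
      fst_sigma, snd_sigma, fst_eta, snd_eta, fst_dx, snd_dx, fst_theta, snd_theta,
      smul_eq_mul, MulOpposite.smul_eq_mul_unop, MulOpposite.unop_op, neg_zero, sub_zero, zero_sub,
      add_zero, zero_add, sub_self,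
      TrivSqZeroExt.fst_neg, TrivSqZeroExt.snd_neg, TrivSqZeroExt.fst_zero, TrivSqZeroExt.snd_zero]
    all_goals first
    | ring1
    | linear_combination m * circleDeriv (circleDeriv F.fst) * G.snd * hk
    | linear_combination -m * F.snd * circleDeriv (circleDeriv G.fst) * hk
    | linear_combination k * circleDeriv F.fst * G.snd * hk
    | linear_combination -k * circleDeriv F.fst * G.snd * hk
    | linear_combination k * F.snd * circleDeriv G.fst * hk
    | linear_combination -k * F.snd * circleDeriv G.fst * hk
    | linear_combination -k * F.snd * G.snd * hk

/-! ### Conjugation by `η̄` -/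

/-- The expansion of `X / (1 + X)`. -/
noncomputable def altSeries (𝕜 : Type*) [RCLike 𝕜] : PowerSeries 𝕜 :=
  PowerSeries.mk fun n => if n = 0 then 0 else (-1) ^ (n + 1)

theorem etaBarPow_one_zero : (etaBarPow (𝕜 := 𝕜) 1).1 0 = 0 := by
  simp [etaBarPow, monomial_of_ne (show (0 : ℤ) ≠ 1 by simp),
    monomial_of_ne (show (0 : ℤ) ≠ 2 by simp)]

theorem etaBarPow_one_one : (etaBarPow (𝕜 := 𝕜) 1).1 1 = 1 := by
  simp [etaBarPow, monomial_same, monomial_of_ne (show (1 : ℤ) ≠ 2 by simp)]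

theorem etaBarPow_one_two : (etaBarPow (𝕜 := 𝕜) 1).1 2 = (-2 : 𝕜) • theta := by
  simp [etaBarPow, monomial_same, monomial_of_ne (show (2 : ℤ) ≠ 1 by simp)]

theorem etaBarPow_one_support (k : ℤ) (h1 : k ≠ 1) (h2 : k ≠ 2) :
    (etaBarPow (𝕜 := 𝕜) 1).1 k = 0 := by
  simp [etaBarPow, monomial_of_ne h1, monomial_of_ne h2]

theorem etaBarPow_one_comp_coeff (A : SPDO 𝕜) (N : ℤ) : (comp (etaBarPow 1) A).1 N =
    sigma (A.1 (N - 1)) + eta (A.1 N) + (-2 : 𝕜) • (theta * (A.1 (N - 2) + dx (A.1 N))) := by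
  rw [comp_coeff_of_support fun k _ => etaBarPow_one_support k, etaBarPow_one_zero,
    etaBarPow_one_one, etaBarPow_one_two, zero_mul, one_mul, zero_add, smul_mul_assoc]

theorem comp_etaBarPow_one_cancel (A B : SPDO 𝕜)
    (h : comp (etaBarPow 1) A = comp (etaBarPow 1) B) : A = B := by
  -- `η̄ ∘ η̄ = -η²`, and left composition with `η` is injective
  have h2 : ∀ C : SPDO 𝕜, comp (etaBarPow 1) (comp (etaBarPow 1) C) = -etaLeft (etaLeft C) := by
    intro C
    refine Subtype.ext (funext fun N => ?_)
    rw [NegMemClass.coe_neg, Pi.neg_apply]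
    simp only [etaBarPow_one_comp_coeff, etaLeft_coeff]
    ring_nf
    ext <;>
    simp only [TrivSqZeroExt.fst_add, TrivSqZeroExt.snd_add, TrivSqZeroExt.fst_mul,
      TrivSqZeroExt.snd_mul, TrivSqZeroExt.fst_smul, TrivSqZeroExt.snd_smul,
      TrivSqZeroExt.fst_neg, TrivSqZeroExt.snd_neg, TrivSqZeroExt.fst_sub, TrivSqZeroExt.snd_sub,
      fst_sigma, snd_sigma, fst_eta, snd_eta, fst_dx, snd_dx, fst_theta, snd_theta,
      smul_eq_mul, MulOpposite.smul_eq_mul_unop, MulOpposite.unop_op, map_add, map_neg, map_smul,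
      map_zero, zero_mul, one_mul] <;>
    module
  refine etaLeft_injective (etaLeft_injective ?_)
  rw [← neg_inj, ← h2, ← h2, h]

theorem fst_theta_mul (F : SFun 𝕜) : (theta * F).fst = 0 := by simp [fst_theta]

theorem snd_theta_mul (F : SFun 𝕜) : (theta * F).snd = F.fst := by simp [fst_theta, snd_theta]

/-- The operator `η̄` intertwines densities of weights `0` and `1/2`. -/
theorem etaBarPow_one_comp_densityOp_zero (F : SFun 𝕜) :
    comp (etaBarPow 1) (densityOp 0 F) = comp (densityOp 2⁻¹ (sigma F)) (etaBarPow 1) := by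
  refine Subtype.ext (funext fun N => ?_)
  rw [etaBarPow_one_comp_coeff, comp_coeff_of_support (densityOp_support _ _)]
  have hN : N = 0 ∨ N = 1 ∨ N = 2 ∨ N = 3 ∨ N = 4 ∨ (N ≠ 0 ∧ N ≠ 1 ∧ N ≠ 2 ∧ N ≠ 3 ∧ N ≠ 4) := by
    omega
  have z (k : ℤ) (h0 : k ≠ 0) (h1 : k ≠ 1) (h2 : k ≠ 2) (H : SFun 𝕜) :=
    densityOp_support (0 : 𝕜) H k h0 h1 h2
  have e := etaBarPow_one_support (𝕜 := 𝕜)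
  rcases hN with rfl | rfl | rfl | rfl | rfl | ⟨h0, h1, h2, h3, h4⟩
  case inr.inr.inr.inr.inr =>
    rw [z _ h0 h1 h2, z (N - 1) (by omega) (by omega) (by omega),
      z (N - 2) (by omega) (by omega) (by omega), e _ h1 h2,
      e (N - 1) (by omega) (by omega),
      e (N - 2) (by omega) (by omega)]
    simp
  all_goals
    norm_num only
    simp only [z (-1) (by decide) (by decide) (by decide),
      z (-2) (by decide) (by decide) (by decide),
      z 3 (by decide) (by decide) (by decide), z 4 (by decide) (by decide) (by decide),
      e (-1) (by decide) (by decide), e (-2) (by decide) (by decide),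
      e 3 (by decide) (by decide), e 4 (by decide) (by decide),
      etaBarPow_one_zero, etaBarPow_one_one, etaBarPow_one_two,
      densityOp_two, densityOp_one, densityOp_zero]
    apply TrivSqZeroExt.ext <;>
    simp only [map_sub, map_smul, map_neg,
      map_zero, mul_zero, zero_mul, mul_one, one_mul, zero_smul, smul_zero, mul_neg,
      mul_add,
      TrivSqZeroExt.fst_add, TrivSqZeroExt.snd_add, TrivSqZeroExt.fst_mul, TrivSqZeroExt.snd_mul,
      TrivSqZeroExt.fst_sub, TrivSqZeroExt.snd_sub, TrivSqZeroExt.fst_smul, TrivSqZeroExt.snd_smul,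
      fst_sigma, snd_sigma, fst_eta, snd_eta, fst_dx, snd_dx, fst_theta, snd_theta,
      smul_eq_mul, MulOpposite.smul_eq_mul_unop, MulOpposite.unop_op, neg_zero, sub_zero,
      add_zero, zero_add, sub_self, circleDeriv_one, mul_smul_comm, smul_mul_assoc,
      TrivSqZeroExt.fst_zero,
      TrivSqZeroExt.snd_zero, TrivSqZeroExt.fst_one, TrivSqZeroExt.snd_one]
  all_goals module

/-- The operator `η̄` carries the operators of the series `X / (1 + X)` to `F ↦ F'`. -/
theorem etaBarPow_one_comp_altSeries (F : SFun 𝕜) :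
    comp (etaBarPow 1) (stdOp (altSeries 𝕜) (altSeries 𝕜) F) =
      comp (stdOp 0 PowerSeries.X (sigma F)) (etaBarPow 1) := by
  have hX : ∀ k, k ≠ 0 → (stdOp 0 PowerSeries.X (sigma F)).1 k = 0 := fun k hk => by
    rw [← Theta1_eq_stdOp, Theta1, monomial_of_ne hk]
  have hX0 : (stdOp 0 PowerSeries.X (sigma F)).1 0 = dx (sigma F) := by
    rw [← Theta1_eq_stdOp, Theta1, monomial_same, pow_two, Module.End.mul_apply, eta_eta]
  have hw0 : (altSeries 𝕜).coeff 0 = 0 := by simp [altSeries]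
  have hw1 : (altSeries 𝕜).coeff 1 = 1 := by simp [altSeries]
  have hw : ∀ n, (altSeries 𝕜).coeff (n + 1 + 1) = -(altSeries 𝕜).coeff (n + 1) := by
    intro n
    simp [altSeries, pow_succ]
  have hz : ∀ k, 0 < k → (stdOp (altSeries 𝕜) (altSeries 𝕜) F).1 k = 0 := by
    intro k hk
    by_cases h2 : 2 < k
    · exact stdOp_eq_zero _ _ _ h2
    obtain rfl | rfl : k = 2 ∨ k = 1 := by omega
    · have := stdOp_even (altSeries 𝕜) (altSeries 𝕜) F 0
      simpa [hw0] using this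
    · have := stdOp_odd (altSeries 𝕜) (altSeries 𝕜) F 0
      simpa [hw0] using this
  refine SPDO.ext_std (fun k hk => ?_) (fun n => ?_) fun n => ?_ <;>
    rw [etaBarPow_one_comp_coeff, comp_coeff_of_support (fun k h _ _ => hX k h), hX 1 (by simp),
      hX 2 (by simp), hX0, zero_mul, zero_mul, add_zero, add_zero]
  · rw [hz k (by omega), hz (k - 1) (by omega), hz (k - 2) (by omega),
      etaBarPow_one_support k (by omega) (by omega)]
    simp
  · have h1 : (2 : ℤ) - 2 * n - 1 = 1 - 2 * n := by ring
    have h2 : (2 : ℤ) - 2 * n - 2 = 2 - 2 * ((n + 1 : ℕ) : ℤ) := by push_cast; ring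
    rw [h1, h2]
    cases n with
    | zero =>
      apply TrivSqZeroExt.ext <;>
      simp only [TrivSqZeroExt.fst_add, TrivSqZeroExt.snd_add, TrivSqZeroExt.fst_smul,
        TrivSqZeroExt.snd_smul, fst_sigma, snd_sigma, fst_eta, snd_eta, fst_dx,
        fst_theta_mul, snd_theta_mul, stdOp_even_fst, stdOp_even_snd, stdOp_odd_fst,
        stdOp_odd_snd] <;>
      simp [fst_sigma, snd_sigma, fst_dx, snd_dx, hw0, hw1,
        etaBarPow_one_two, fst_theta, snd_theta]
    | succ n =>
      rw [etaBarPow_one_support (2 - 2 * ((n + 1 : ℕ) : ℤ)) (by omega) (by omega),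
        mul_zero]
      apply TrivSqZeroExt.ext <;>
      simp only [TrivSqZeroExt.fst_add, TrivSqZeroExt.snd_add, TrivSqZeroExt.fst_smul,
        TrivSqZeroExt.snd_smul, fst_sigma, snd_sigma, fst_eta, snd_eta, fst_dx,
        fst_theta_mul, snd_theta_mul, stdOp_even_fst, stdOp_even_snd, stdOp_odd_fst,
        stdOp_odd_snd, hw, pow_succ' circleDeriv, Module.End.mul_apply, map_smul,
        TrivSqZeroExt.fst_zero, TrivSqZeroExt.snd_zero] <;>
      module
  · have h1 : (1 : ℤ) - 2 * n - 1 = 2 - 2 * ((n + 1 : ℕ) : ℤ) := by push_cast; ring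
    have h2 : (1 : ℤ) - 2 * n - 2 = 1 - 2 * ((n + 1 : ℕ) : ℤ) := by push_cast; ring
    rw [h1, h2]
    cases n with
    | zero =>
      apply TrivSqZeroExt.ext <;>
      simp only [TrivSqZeroExt.fst_add, TrivSqZeroExt.snd_add, TrivSqZeroExt.fst_smul,
        TrivSqZeroExt.snd_smul, fst_sigma, snd_sigma, fst_eta, snd_eta, fst_dx,
        fst_theta_mul, snd_theta_mul, stdOp_even_fst, stdOp_even_snd, stdOp_odd_fst,
        stdOp_odd_snd] <;>
      simp [fst_sigma, snd_sigma, fst_dx, snd_dx, hw0, hw1,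
        etaBarPow_one_one]
      all_goals module
    | succ n =>
      rw [etaBarPow_one_support (1 - 2 * ((n + 1 : ℕ) : ℤ)) (by omega) (by omega),
        mul_zero]
      apply TrivSqZeroExt.ext <;>
      simp only [TrivSqZeroExt.fst_add, TrivSqZeroExt.snd_add, TrivSqZeroExt.fst_smul,
        TrivSqZeroExt.snd_smul, fst_sigma, snd_sigma, fst_eta, snd_eta, fst_dx,
        fst_theta_mul, snd_theta_mul, stdOp_even_fst, stdOp_even_snd, stdOp_odd_fst,
        stdOp_odd_snd, hw, pow_succ' circleDeriv, Module.End.mul_apply, map_smul,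
        TrivSqZeroExt.fst_zero, TrivSqZeroExt.snd_zero] <;>
      module

open PowerSeries in
/-- Densities of weight `1/2 + c` conjugated by `η̄`. For `c = 0` the result is `ρ`, as `η̄`
intertwines the weights `0` and `1/2`. -/
theorem preservesBracket_altSeries (c : 𝕜) :
    PreservesBracket (stdOp (C (2⁻¹ : 𝕜) + c • altSeries 𝕜) (1 + c • altSeries 𝕜)) := by
  refine (preservesBracket_densityOp (2⁻¹ + c)).of_comp_left (etaBarPow 1)
    comp_etaBarPow_one_cancel fun F => ?_
  have h0 : stdOp (C (2⁻¹ : 𝕜)) 1 F = densityOp 0 F := by simp [densityOp]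
  have h1 : densityOp (2⁻¹ + c) (sigma F) =
      densityOp 2⁻¹ (sigma F) + c • stdOp 0 X (sigma F) := by
    rw [densityOp, densityOp, ← stdOp_smul_series, ← stdOp_add_series]
    congr 1
    · simp
    · rw [map_add, smul_eq_C_mul]; ring
  rw [stdOp_add_series, stdOp_smul_series, comp_add, comp_smul, h0,
    etaBarPow_one_comp_densityOp_zero, etaBarPow_one_comp_altSeries, h1, add_comp, smul_comp]

/-! ### Families that depend polynomially on a parameter -/

section PolyFamily

variable (M : Type*) [AddCommGroup M] [Module 𝕜 M]

/-- Functions of a scalar `t` with values in `M` that are finite sums `∑ p(t) v` with polynomials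
`p` and vectors `v`. -/
def polyFamily : Submodule 𝕜 (𝕜 → M) :=
  Submodule.span 𝕜 {h | ∃ (p : Polynomial 𝕜) (v : M), h = fun t => p.eval t • v}

variable {M}

theorem polyFamily_map {M' : Type*} [AddCommGroup M'] [Module 𝕜 M'] (f : M →ₗ[𝕜] M')
    {h : 𝕜 → M} (hh : h ∈ polyFamily M) : (fun t => f (h t)) ∈ polyFamily M' := by
  induction hh using Submodule.span_induction with
  | mem x hx =>
    obtain ⟨p, v, rfl⟩ := hx
    exact Submodule.subset_span ⟨p, f v, by simp⟩
  | zero =>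
    simp only [Pi.zero_apply, map_zero]
    exact Submodule.zero_mem _
  | add x y _ _ hx hy =>
    simp only [Pi.add_apply, map_add]
    exact Submodule.add_mem _ hx hy
  | smul a x _ hx =>
    simp only [Pi.smul_apply, map_smul]
    exact Submodule.smul_mem _ a hx

theorem polyFamily_eval_smul (p : Polynomial 𝕜) (v : M) :
    (fun t => p.eval t • v) ∈ polyFamily M := Submodule.subset_span ⟨p, v, rfl⟩

theorem polyFamily_mul {A : Type*} [CommRing A] [Algebra 𝕜 A] {f g : 𝕜 → A}
    (hf : f ∈ polyFamily A) (hg : g ∈ polyFamily A) : (fun t => f t * g t) ∈ polyFamily A := by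
  induction hf using Submodule.span_induction with
  | mem x hx =>
    obtain ⟨p, v, rfl⟩ := hx
    induction hg using Submodule.span_induction with
    | mem y hy =>
      obtain ⟨q, w, rfl⟩ := hy
      exact Submodule.subset_span ⟨p * q, v * w, by
        funext t
        rw [Polynomial.eval_mul, smul_mul_smul_comm]⟩
    | zero =>
      simp only [Pi.zero_apply, mul_zero]
      exact Submodule.zero_mem _
    | add y z _ _ hy hz =>
      simp only [Pi.add_apply, mul_add]
      exact Submodule.add_mem _ hy hz
    | smul a y _ hy =>
      simp only [Pi.smul_apply, mul_smul_comm]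
      exact Submodule.smul_mem _ a hy
  | zero =>
    simp only [Pi.zero_apply, zero_mul]
    exact Submodule.zero_mem _
  | add y z _ _ hy hz =>
    simp only [Pi.add_apply, add_mul]
    exact Submodule.add_mem _ hy hz
  | smul a y _ hy =>
    simp only [Pi.smul_apply, smul_mul_assoc]
    exact Submodule.smul_mem _ a hy

/-- A polynomial family that vanishes at all natural numbers vanishes identically. -/
theorem polyFamily_eq_zero {h : 𝕜 → M} (hh : h ∈ polyFamily M) (h0 : ∀ n : ℕ, h n = 0) (t : 𝕜) :
    h t = 0 := by
  refine (Module.forall_dual_apply_eq_zero_iff 𝕜 _).1 fun f => ?_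
  obtain ⟨p, hp⟩ : ∃ p : Polynomial 𝕜, ∀ t, f (h t) = p.eval t := by
    clear h0
    induction hh using Submodule.span_induction with
    | mem x hx =>
      obtain ⟨p, v, rfl⟩ := hx
      exact ⟨p * Polynomial.C (f v), fun t => by simp⟩
    | zero => exact ⟨0, fun t => by simp⟩
    | add y z _ _ hy hz =>
      obtain ⟨p, hp⟩ := hy
      obtain ⟨q, hq⟩ := hz
      exact ⟨p + q, fun t => by simp [hp, hq]⟩
    | smul a y _ hy =>
      obtain ⟨p, hp⟩ := hy
      exact ⟨Polynomial.C a * p, fun t => by simp [hp]⟩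
  have hp0 : p = 0 := by
    refine Polynomial.eq_zero_of_infinite_isRoot p ?_
    refine (Set.infinite_range_of_injective (Nat.cast_injective (R := 𝕜))).mono ?_
    rintro _ ⟨n, rfl⟩
    rw [Set.mem_ofPred_eq, Polynomial.IsRoot, ← hp, h0, map_zero]
  rw [hp, hp0, Polynomial.eval_zero]

end PolyFamily

/-- The compositions of two polynomial families of operators of bounded order form a polynomial
family. -/
theorem polyFamily_comp {A B : 𝕜 → SPDO 𝕜} {q b : ℤ} (hA : ∀ t k, q < k → (A t).1 k = 0)
    (hB : ∀ t k, b < k → (B t).1 k = 0) (hA' : ∀ k, (fun t => (A t).1 k) ∈ polyFamily (SFun 𝕜))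
    (hB' : ∀ k, (fun t => (B t).1 k) ∈ polyFamily (SFun 𝕜)) (N : ℤ) :
    (fun t => (comp (A t) (B t)).1 N) ∈ polyFamily (SFun 𝕜) := by
  obtain ⟨K, hK⟩ : ∃ K : ℕ, b - N + q < K := ⟨(b - N + q + 1).toNat, by omega⟩
  have hs : ∀ (j k : ℤ), (fun t => sigmaPow j ((B t).1 k)) ∈ polyFamily (SFun 𝕜) := by
    intro j k
    unfold sigmaPow
    split_ifs
    · exact hB' k
    · exact polyFamily_map sigma (hB' k)
  have h1 : (fun t => (comp (A t) (B t)).1 N) = ∑ m ∈ Finset.Icc (N - b) q,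
      ∑ k ∈ Finset.range K, (superChoose m k : 𝕜) • fun t =>
        (A t).1 m * (eta ^ k) (sigmaPow (m - k) ((B t).1 (N - m + k))) := by
    funext t
    rw [comp_coeff (hA t) (hB t) N le_rfl hK]
    simp only [Finset.sum_apply, Pi.smul_apply, Int.cast_smul_eq_zsmul]
  rw [h1]
  exact Submodule.sum_mem _ fun m _ => Submodule.sum_mem _ fun k _ =>
    Submodule.smul_mem _ _ (polyFamily_mul (hA' m) (polyFamily_map _ (hs _ _)))

/-- The polynomial whose value at `t` is the binomial coefficient `binom t k`. -/
noncomputable def choosePoly (𝕜 : Type*) [RCLike 𝕜] (k : ℕ) : Polynomial 𝕜 :=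
  Polynomial.C ((k.factorial : 𝕜)⁻¹) * descPochhammer 𝕜 k

theorem choosePoly_eval (k : ℕ) (t : 𝕜) : (choosePoly 𝕜 k).eval t = Ring.choose t k := by
  rw [choosePoly, Ring.choose_eq_smul, Polynomial.eval_mul, Polynomial.eval_C, smul_eq_mul,
    ← Polynomial.aeval_eq_smeval, Polynomial.aeval_def, Polynomial.eval₂_eq_eval_map,
    descPochhammer_map]

open PowerSeries in
/-- If the operators of `(U, V)` preserve brackets, so do those of
`((1 + X)^μ U, (1 + X)^μ V)`. For a natural number `μ` this is conjugation by `η^{2μ}`, and both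
sides depend polynomially on `μ`. -/
theorem PreservesBracket.binomialSeries_mul {U V : PowerSeries 𝕜}
    (h : PreservesBracket (stdOp U V)) (μ : 𝕜) :
    PreservesBracket
      (stdOp (PowerSeries.binomialSeries 𝕜 μ * U) (PowerSeries.binomialSeries 𝕜 μ * V)) := by
  obtain ⟨S, hS⟩ : ∃ S : 𝕜 → SFun 𝕜 → SPDO 𝕜, ∀ t,
      S t = stdOp (PowerSeries.binomialSeries 𝕜 t * U) (PowerSeries.binomialSeries 𝕜 t * V) :=
    ⟨_, fun _ => rfl⟩
  rw [← hS]
  have hnat : ∀ n : ℕ, PreservesBracket (S n) := by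
    intro n
    rw [hS, binomialSeries_nat]
    induction n with
    | zero => simpa using h
    | succ n ih =>
      rw [pow_succ', mul_assoc, mul_assoc]
      exact ih.one_add_X_mul
  have hc : ∀ (T : PowerSeries 𝕜) (n : ℕ), ∃ p : Polynomial 𝕜, ∀ t,
      coeff n (PowerSeries.binomialSeries 𝕜 t * T) = p.eval t := by
    intro T n
    refine ⟨∑ x ∈ Finset.HasAntidiagonal.antidiagonal n,
      choosePoly 𝕜 x.1 * Polynomial.C (coeff x.2 T), fun t => ?_⟩
    simp [coeff_mul, Polynomial.eval_finsetSum, choosePoly_eval]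
  have hpoly : ∀ (F : SFun 𝕜) (k : ℤ), (fun t => (S t F).1 k) ∈ polyFamily (SFun 𝕜) := by
    intro F k
    obtain ⟨p, hp⟩ := hc U ((2 - k) / 2).toNat
    obtain ⟨q, hq⟩ := hc V ((2 - k) / 2).toNat
    obtain ⟨r, hr⟩ := hc U ((1 - k) / 2).toNat
    simp only [hS, stdOp, hp, hq, hr]
    split_ifs
    · exact Submodule.zero_mem _
    · refine Submodule.sub_mem _ (polyFamily_eval_smul q _) ?_
      simp only [mul_smul]
      exact Submodule.smul_mem _ (2 : 𝕜) (polyFamily_eval_smul p _)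
    · exact polyFamily_eval_smul r _
  have hb : ∀ (H : SFun 𝕜) (t : 𝕜) (k : ℤ), 2 < k → (S t H).1 k = 0 := fun H t k hk => by
    rw [hS, stdOp_eq_zero _ _ _ hk]
  intro i j F G
  refine Subtype.ext (funext fun N => ?_)
  have hz := polyFamily_eq_zero (M := SFun 𝕜) (h := fun t =>
      (S t (contactBracket (superPart i F) (superPart j G))).1 N -
      ((comp (S t (superPart i F)) (S t (superPart j G))).1 N -
        (-1 : 𝕜) ^ ((i : ℕ) * (j : ℕ)) •
          (comp (S t (superPart j G)) (S t (superPart i F))).1 N)) ?_ ?_ μ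
  · exact sub_eq_zero.1 hz
  · exact Submodule.sub_mem _ (hpoly _ _) (Submodule.sub_mem _
      (polyFamily_comp (hb _) (hb _) (hpoly _) (hpoly _) N)
      (Submodule.smul_mem _ _ (polyFamily_comp (hb _) (hb _) (hpoly _) (hpoly _) N)))
  · intro n
    rw [hnat n i j F G]
    exact sub_self _

/-! ### First order expansions of polynomial families -/

/-- Polynomial functions of one variable that are divisible by the `d`-th power of the variable. -/
def polyOrder (𝕜 : Type*) [RCLike 𝕜] (d : ℕ) : Submodule 𝕜 (𝕜 → 𝕜) where
  carrier := {f | ∃ p : Polynomial 𝕜, Polynomial.X ^ d ∣ p ∧ ∀ t, f t = p.eval t}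
  add_mem' := by
    rintro f g ⟨p, hp, hf⟩ ⟨q, hq, hg⟩
    exact ⟨p + q, dvd_add hp hq, fun t => by simp [hf, hg]⟩
  zero_mem' := ⟨0, dvd_zero _, fun t => by simp⟩
  smul_mem' := by
    rintro a f ⟨p, hp, hf⟩
    exact ⟨Polynomial.C a * p, hp.mul_left _, fun t => by simp [hf]⟩

theorem polyOrder_mono {d e : ℕ} (h : e ≤ d) {f : 𝕜 → 𝕜} (hf : f ∈ polyOrder 𝕜 d) :
    f ∈ polyOrder 𝕜 e := by
  obtain ⟨p, hp, hf⟩ := hf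
  exact ⟨p, (pow_dvd_pow _ h).trans hp, hf⟩

theorem mul_mem_polyOrder {d : ℕ} {f : 𝕜 → 𝕜} (hf : f ∈ polyOrder 𝕜 d) :
    (fun t => t * f t) ∈ polyOrder 𝕜 (d + 1) := by
  obtain ⟨p, ⟨q, rfl⟩, hf⟩ := hf
  exact ⟨Polynomial.X * (Polynomial.X ^ d * q), ⟨q, by ring⟩, fun t => by simp [hf]⟩

theorem eval_mem_polyOrder_zero (p : Polynomial 𝕜) : (fun t => p.eval t) ∈ polyOrder 𝕜 0 :=
  ⟨p, by simp, fun _ => rfl⟩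

theorem choosePoly_succ (n : ℕ) : choosePoly 𝕜 (n + 1) =
    Polynomial.C ((n + 1 : 𝕜)⁻¹) * (choosePoly 𝕜 n * (Polynomial.X - (n : Polynomial 𝕜))) := by
  rw [choosePoly, choosePoly, descPochhammer_succ_right, Nat.factorial_succ, Nat.cast_mul,
    mul_inv, Polynomial.C_mul, Nat.cast_succ]
  ring

theorem choosePoly_coeff_zero (n : ℕ) : (choosePoly 𝕜 n).coeff 0 = if n = 0 then 1 else 0 := by
  induction n with
  | zero => simp [choosePoly]
  | succ n ih =>
    rw [choosePoly_succ]
    simp only [Polynomial.mul_coeff_zero, ih]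
    by_cases h : n = 0 <;> simp [h]

/-- The coefficients of `log (1 + X)`. -/
noncomputable def logCoeff (𝕜 : Type*) [RCLike 𝕜] (n : ℕ) : 𝕜 :=
  if n = 0 then 0 else (-1) ^ (n + 1) / n

theorem choosePoly_coeff_one (n : ℕ) : (choosePoly 𝕜 n).coeff 1 = logCoeff 𝕜 n := by
  induction n with
  | zero => simp [choosePoly, logCoeff, Polynomial.coeff_one]
  | succ n ih =>
    rw [choosePoly_succ, mul_sub, Polynomial.coeff_C_mul, Polynomial.coeff_sub,
      Polynomial.coeff_mul_X (choosePoly 𝕜 n) 0, choosePoly_coeff_zero,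
      ← Polynomial.C_eq_natCast, Polynomial.coeff_mul_C, ih]
    have h1 : (n + 1 : 𝕜) ≠ 0 := by exact_mod_cast n.succ_ne_zero
    by_cases h : n = 0
    · simp [h, logCoeff]
    · have h2 : (n : 𝕜) ≠ 0 := by exact_mod_cast h
      simp only [logCoeff, if_neg h, if_neg n.succ_ne_zero, Nat.cast_succ]
      field_simp
      ring

/-- The first order expansion of `(1 + X)^{2t}` in `t`. -/
theorem choose_two_mul_mem_polyOrder (n : ℕ) : (fun t : 𝕜 => Ring.choose (2 * t) n -
    (if n = 0 then 1 else 0) - t * (2 * logCoeff 𝕜 n)) ∈ polyOrder 𝕜 2 := by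
  refine ⟨(choosePoly 𝕜 n).comp (Polynomial.C 2 * Polynomial.X) -
    Polynomial.C (if n = 0 then 1 else 0) - Polynomial.C (2 * logCoeff 𝕜 n) * Polynomial.X,
    Polynomial.X_pow_dvd_iff.2 fun d hd => ?_, fun t => ?_⟩
  · have : d = 0 ∨ d = 1 := by omega
    rcases this with rfl | rfl
    · rw [Polynomial.coeff_sub, Polynomial.coeff_sub, Polynomial.comp_C_mul_X_coeff,
        choosePoly_coeff_zero, Polynomial.coeff_C_zero]
      simp
    · rw [Polynomial.coeff_sub, Polynomial.coeff_sub, Polynomial.comp_C_mul_X_coeff,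
        choosePoly_coeff_one, Polynomial.coeff_C_of_ne_zero one_ne_zero]
      simp [mul_comm]
  · simp only [Polynomial.eval_sub, Polynomial.eval_comp, Polynomial.eval_mul, Polynomial.eval_C,
      Polynomial.eval_X, choosePoly_eval]
    ring

theorem id_smul_mem_polyOrder (a : 𝕜) : (fun t : 𝕜 => t * a) ∈ polyOrder 𝕜 1 :=
  ⟨Polynomial.X * Polynomial.C a, ⟨Polynomial.C a, by ring⟩, fun t => by
    rw [Polynomial.eval_mul, Polynomial.eval_X, Polynomial.eval_C]⟩

open PowerSeries in
theorem coeff_binomialSeries_mul_sub_mem (S : PowerSeries 𝕜) (n : ℕ) :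
    (fun t : 𝕜 => coeff n (PowerSeries.binomialSeries 𝕜 (2 * t) * S) - coeff n S) ∈
      polyOrder 𝕜 1 := by
  have h : (fun t : 𝕜 => coeff n (PowerSeries.binomialSeries 𝕜 (2 * t) * S) - coeff n S) =
      ∑ x ∈ Finset.HasAntidiagonal.antidiagonal n, coeff x.2 S •
        fun t : 𝕜 => Ring.choose (2 * t) x.1 - (if x.1 = 0 then 1 else 0) := by
    funext t
    have h1 : coeff n S = ∑ x ∈ Finset.HasAntidiagonal.antidiagonal n,
        (if x.1 = 0 then 1 else 0) * coeff x.2 S := by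
      conv_lhs => rw [← one_mul S, coeff_mul]
      simp only [coeff_one]
    conv_lhs => rw [h1, coeff_mul, ← Finset.sum_sub_distrib]
    rw [Finset.sum_apply]
    refine Finset.sum_congr rfl fun x _ => ?_
    simp only [binomialSeries_coeff, smul_eq_mul, mul_one, Pi.smul_apply]
    ring
  rw [h]
  refine Submodule.sum_mem _ fun x _ => Submodule.smul_mem _ _ ?_
  have := Submodule.add_mem _ (polyOrder_mono one_le_two (choose_two_mul_mem_polyOrder x.1))
    (id_smul_mem_polyOrder (2 * logCoeff 𝕜 x.1))
  convert this using 1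
  funext t
  simp

open PowerSeries in
/-- The first order expansion of `(1 + X)^{2t} (a + t S)` in `t`. -/
theorem coeff_conj_sub_mem (a : 𝕜) (S : PowerSeries 𝕜) (n : ℕ) :
    (fun t : 𝕜 => coeff n (PowerSeries.binomialSeries 𝕜 (2 * t) * (C a + t • S)) -
      coeff n (C a) - t * (2 * logCoeff 𝕜 n * a + coeff n S)) ∈ polyOrder 𝕜 2 := by
  have := Submodule.add_mem _ (Submodule.smul_mem _ a (choose_two_mul_mem_polyOrder (𝕜 := 𝕜) n))
    (mul_mem_polyOrder (coeff_binomialSeries_mul_sub_mem S n))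
  convert this using 1
  funext t
  simp only [mul_add, map_add, coeff_mul_C, mul_smul_comm, map_smul, Pi.add_apply, Pi.smul_apply,
    smul_eq_mul, binomialSeries_coeff, coeff_C]
  split_ifs <;> ring

theorem isDiffOp_eta_pow (n : ℕ) (a b : SFun 𝕜) :
    IsDiffOp fun F => a * (eta ^ n) F + b * (eta ^ (n + 1)) F := by
  refine ⟨n + 2, fun j => if j = n then a else if j = n + 1 then b else 0, fun F => ?_⟩
  rw [Finset.sum_range_succ, Finset.sum_range_succ, Finset.sum_eq_zero]
  · simp
  · intro j hj
    have := Finset.mem_range.1 hj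
    simp [show j ≠ n by omega, show j ≠ n + 1 by omega]

theorem dx_pow_eq (n : ℕ) (F : SFun 𝕜) : (dx ^ n) F = (eta ^ (2 * n)) F := by
  have : (dx : SFun 𝕜 →ₗ[𝕜] SFun 𝕜) = eta ^ 2 := by
    refine LinearMap.ext fun G => ?_
    rw [pow_two, Module.End.mul_apply, eta_eta]
  rw [this, ← pow_mul]

/-- Each coefficient of `stdOp U V F` is `vₙ A F + uₙ B F` with differential operators `A`, `B`
and an index `n` that do not depend on the series. -/
theorem stdOp_coeff_eq (k : ℤ) : ∃ (n m : ℕ) (a b : SFun 𝕜), ∀ (U V : PowerSeries 𝕜) F,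
    (stdOp U V F).1 k =
      V.coeff n • (a * (eta ^ m) F) + U.coeff n • (b * (eta ^ (m + 1)) F) := by
  by_cases hk : 2 < k
  · exact ⟨0, 0, 0, 0, fun U V F => by rw [stdOp_eq_zero _ _ _ hk]; simp⟩
  obtain ⟨l, rfl | rfl⟩ := Int.even_or_odd' k
  · obtain ⟨n, rfl⟩ : ∃ n : ℕ, l = 1 - n := ⟨(1 - l).toNat, by omega⟩
    refine ⟨n, 2 * n, 1, (-2 : 𝕜) • theta, fun U V F => ?_⟩
    rw [mul_sub, mul_one, stdOp_even, pow_succ, Module.End.mul_apply, ← dx_pow_eq, ← dx_pow_eq,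
      smul_mul_assoc, one_mul, mul_comm theta, add_comm]
  · obtain ⟨n, rfl⟩ : ∃ n : ℕ, l = -n := ⟨(-l).toNat, by omega⟩
    refine ⟨n, 2 * n, 0, 1, fun U V F => ?_⟩
    rw [show 2 * -(n : ℤ) + 1 = 1 - 2 * n by ring, stdOp_odd, pow_succ, Module.End.mul_apply,
      dx_pow_eq]
    simp only [zero_mul, smul_zero, one_mul, zero_add]

theorem isPolynomialFamily_stdOp {d : ℕ} {U V : 𝕜 → PowerSeries 𝕜}
    (hU : ∀ n, (fun t => (U t).coeff n) ∈ polyOrder 𝕜 d)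
    (hV : ∀ n, (fun t => (V t).coeff n) ∈ polyOrder 𝕜 d) :
    IsPolynomialFamily d fun (t : Fin 1 → 𝕜) F => stdOp (U (t 0)) (V (t 0)) F := by
  intro k
  obtain ⟨n, m, a, b, h⟩ := stdOp_coeff_eq (𝕜 := 𝕜) k
  obtain ⟨p, hp, hp'⟩ := hU n
  obtain ⟨q, hq, hq'⟩ := hV n
  rw [Polynomial.X_pow_dvd_iff] at hp hq
  beta_reduce at hp' hq'
  set M := max p.natDegree q.natDegree + 1
  refine ⟨(Finset.Ico d M).map ⟨fun i => Finsupp.single 0 i, Finsupp.single_injective 0⟩,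
    fun α F => (q.coeff (α 0) • a) * (eta ^ m) F + (p.coeff (α 0) • b) * (eta ^ (m + 1)) F,
    fun α hα => ⟨?_, isDiffOp_eta_pow _ _ _⟩, fun t F => ?_⟩
  · obtain ⟨i, hi, rfl⟩ := Finset.mem_map.1 hα
    rw [Function.Embedding.coeFn_mk, Finsupp.degree_single]
    exact (Finset.mem_Ico.1 hi).1
  · have hev : ∀ r : Polynomial 𝕜, (∀ i < d, r.coeff i = 0) → r.natDegree < M →
        r.eval (t 0) = ∑ i ∈ Finset.Ico d M, t 0 ^ i * r.coeff i := by
      intro r hr hM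
      rw [Polynomial.eval_eq_sum_range' hM, Finset.range_eq_Ico]
      simp only [mul_comm (r.coeff _)]
      refine (Finset.sum_subset (Finset.Ico_subset_Ico_left d.zero_le) fun i hi hi' => ?_).symm
      rw [Finset.mem_Ico] at hi hi'
      rw [hr i (by omega), mul_zero]
    rw [h, hp', hq', hev p hp (by omega), hev q hq (by omega), Finset.sum_map, Finset.sum_smul,
      Finset.sum_smul, ← Finset.sum_add_distrib]
    refine Finset.sum_congr rfl fun i _ => ?_
    simp [mul_smul]

/-! ### The four curves of deformations -/

/-- The series `U` of `Θ₂`. -/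
noncomputable def thetaTwoU (𝕜 : Type*) [RCLike 𝕜] : PowerSeries 𝕜 :=
  PowerSeries.mk fun n => if n = 0 then 0 else (-1) ^ n * (((n : 𝕜) - 2) / n)

/-- The series `V` of `Θ₂`. -/
noncomputable def thetaTwoV (𝕜 : Type*) [RCLike 𝕜] : PowerSeries 𝕜 :=
  PowerSeries.mk fun n => if n ≤ 1 then 0 else
    (-1) ^ n * ((((n - 1 : ℕ) : 𝕜) - 3) / ((n - 1 : ℕ) + 1))

/-- The series `U` of `Θ₃`. -/
noncomputable def thetaThreeU (𝕜 : Type*) [RCLike 𝕜] : PowerSeries 𝕜 :=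
  PowerSeries.mk fun n => if n = 0 then 0 else (-1) ^ n * (2 * ((n : 𝕜) - 1) / n)

/-- The series `V` of `Θ₃`. -/
noncomputable def thetaThreeV (𝕜 : Type*) [RCLike 𝕜] : PowerSeries 𝕜 :=
  PowerSeries.mk fun n => if n ≤ 1 then 0 else
    (-1) ^ n * (2 * (((n - 1 : ℕ) : 𝕜) - 1) / ((n - 1 : ℕ) + 1))

/-- The series `U` of `ρ + c₁ Θ₁ + c₂ Θ₂ + c₃ Θ₃`. -/
noncomputable def infU (c₂ c₃ : 𝕜) : PowerSeries 𝕜 :=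
  PowerSeries.C (2⁻¹ : 𝕜) + c₂ • thetaTwoU 𝕜 + c₃ • thetaThreeU 𝕜

/-- The series `V` of `ρ + c₁ Θ₁ + c₂ Θ₂ + c₃ Θ₃`. -/
noncomputable def infV (c₁ c₂ c₃ : 𝕜) : PowerSeries 𝕜 :=
  1 + c₁ • PowerSeries.X + c₂ • thetaTwoV 𝕜 + c₃ • thetaThreeV 𝕜

theorem infinitesimalDeformation_eq_stdOp (c₁ c₂ c₃ : 𝕜) (F : SFun 𝕜) :
    infinitesimalDeformation c₁ c₂ c₃ F = stdOp (infU c₂ c₃) (infV c₁ c₂ c₃) F := by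
  rw [infinitesimalDeformation, rho_eq_stdOp, Theta1_eq_stdOp, Theta2, Theta3,
    cocycleSeries_eq_stdOp, cocycleSeries_eq_stdOp, ← stdOp_smul_series, ← stdOp_smul_series,
    ← stdOp_smul_series, ← stdOp_add_series, ← stdOp_add_series, ← stdOp_add_series]
  congr 1
  rw [smul_zero, add_zero]
  rfl

theorem stdOp_sub_series (U V U' V' : PowerSeries 𝕜) (F : SFun 𝕜) :
    stdOp (U - U') (V - V') F = stdOp U V F - stdOp U' V' F := by
  rw [eq_sub_iff_add_eq, ← stdOp_add_series, sub_add_cancel, sub_add_cancel]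

theorem eval_aeval_X_zero (p : Polynomial 𝕜) (t : Fin 1 → 𝕜) :
    (Polynomial.aeval (MvPolynomial.X 0 : MvPolynomial (Fin 1) 𝕜) p).eval t = p.eval (t 0) := by
  induction p using Polynomial.induction_on' with
  | add p q hp hq => simp [hp, hq]
  | monomial n a => simp [MvPolynomial.algebraMap_eq]

/-- A criterion for operators given by two power series: they have to preserve brackets, and their
series have to agree with those of `ρ + γ₁ Θ₁ + γ₂ Θ₂ + γ₃ Θ₃` to first order in `t`, and exactly
up to the coefficient of `X²`, that is, in all degrees above `-4`. -/
theorem correspondsToPolynomialDeformation_of_family {U V : 𝕜 → PowerSeries 𝕜}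
    (p₁ p₂ p₃ : Polynomial 𝕜) (hom : ∀ t, PreservesBracket (stdOp (U t) (V t)))
    (hU0 : U 0 = PowerSeries.C (2⁻¹ : 𝕜)) (hV0 : V 0 = 1)
    (hU : ∀ n, (fun t => (U t).coeff n - (infU (p₂.eval t) (p₃.eval t)).coeff n) ∈ polyOrder 𝕜 2)
    (hV : ∀ n, (fun t => (V t).coeff n -
      (infV (p₁.eval t) (p₂.eval t) (p₃.eval t)).coeff n) ∈ polyOrder 𝕜 2)
    (hUlow : ∀ t, ∀ n ≤ 2, (U t).coeff n = (infU (p₂.eval t) (p₃.eval t)).coeff n)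
    (hVlow : ∀ t, ∀ n ≤ 2, (V t).coeff n = (infV (p₁.eval t) (p₂.eval t) (p₃.eval t)).coeff n)
    (t : 𝕜) : CorrespondsToPolynomialDeformation (p₁.eval t) (p₂.eval t) (p₃.eval t) := by
  refine ⟨1, fun t F => stdOp (U (t 0)) (V (t 0)) F, Polynomial.aeval (MvPolynomial.X 0) p₁,
    Polynomial.aeval (MvPolynomial.X 0) p₂, Polynomial.aeval (MvPolynomial.X 0) p₃,
    fun t F => stdOp (U (t 0) - infU (p₂.eval (t 0)) (p₃.eval (t 0)))
      (V (t 0) - infV (p₁.eval (t 0)) (p₂.eval (t 0)) (p₃.eval (t 0))) F, ?_, ?_, ?_, ?_,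
    fun _ => t, ?_⟩
  · have hsub : (fun (t : Fin 1 → 𝕜) (F : SFun 𝕜) => stdOp (U (t 0)) (V (t 0)) F - rho F) =
        fun t F => stdOp (U (t 0) - PowerSeries.C (2⁻¹ : 𝕜)) (V (t 0) - 1) F := by
      funext t F
      rw [rho_eq_stdOp, stdOp_sub_series]
    refine ⟨fun t => IsSuperLieHom.of_preservesBracket (stdOp_isLinearMap _ _)
      (fun i F => stdOp_superPart _ _ _ _) (hom _), ?_, fun F => ?_, 2, fun t F k hk => ?_⟩
    · rw [hsub]
      have hp : ∀ (p : Polynomial 𝕜) (a : 𝕜), (fun t => p.eval t * a) ∈ polyOrder 𝕜 0 :=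
        fun p a => by simpa using eval_mem_polyOrder_zero (p * Polynomial.C a)
      refine isPolynomialFamily_stdOp (U := fun t => U t - PowerSeries.C (2⁻¹ : 𝕜))
        (V := fun t => V t - 1) (fun n => ?_) fun n => ?_
      · have h := Submodule.add_mem _ (polyOrder_mono (Nat.zero_le 2) (hU n))
          (Submodule.add_mem _ (hp p₂ ((thetaTwoU 𝕜).coeff n))
            (hp p₃ ((thetaThreeU 𝕜).coeff n)))
        convert h using 1
        funext t
        simp only [infU, map_add, map_sub, map_smul, smul_eq_mul, Pi.add_apply]
        ring
      · have h := Submodule.add_mem _ (polyOrder_mono (Nat.zero_le 2) (hV n))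
          (Submodule.add_mem _ (hp p₁ (PowerSeries.X.coeff n)) (Submodule.add_mem _
            (hp p₂ ((thetaTwoV 𝕜).coeff n)) (hp p₃ ((thetaThreeV 𝕜).coeff n))))
        convert h using 1
        funext t
        simp only [infV, map_add, map_sub, map_smul, smul_eq_mul, Pi.add_apply]
        ring
    · simp only [Pi.zero_apply, hU0, hV0, rho_eq_stdOp]
    · have := congrFun (congrFun hsub t) F
      beta_reduce at this
      rw [this, stdOp_eq_zero _ _ _ hk]
  · intro t F
    beta_reduce
    rw [eval_aeval_X_zero, eval_aeval_X_zero, eval_aeval_X_zero,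
      infinitesimalDeformation_eq_stdOp, stdOp_sub_series, add_sub_cancel]
  · exact isPolynomialFamily_stdOp
      (U := fun t => U t - infU (p₂.eval t) (p₃.eval t))
      (V := fun t => V t - infV (p₁.eval t) (p₂.eval t) (p₃.eval t))
      (fun n => by simpa using hU n) fun n => by simpa using hV n
  · intro t F k hk
    by_cases h2 : 2 < k
    · exact stdOp_eq_zero _ _ _ h2
    obtain ⟨l, rfl | rfl⟩ := Int.even_or_odd' k
    · obtain ⟨n, rfl⟩ : ∃ n : ℕ, l = 1 - n := ⟨(1 - l).toNat, by omega⟩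
      rw [mul_sub, mul_one, stdOp_even, map_sub, map_sub, hUlow _ n (by omega),
        hVlow _ n (by omega), sub_self, sub_self, zero_smul, zero_smul, add_zero]
    · obtain ⟨n, rfl⟩ : ∃ n : ℕ, l = -n := ⟨(-l).toNat, by omega⟩
      rw [show 2 * -(n : ℤ) + 1 = 1 - 2 * n by ring, stdOp_odd, map_sub, hUlow _ n (by omega),
        sub_self, zero_smul]
  · simp only [eval_aeval_X_zero, and_self]

/-- The curve `(c, 0, 0)`: densities of weight `c`. -/
theorem corresponds_first_curve (c : 𝕜) : CorrespondsToPolynomialDeformation c 0 0 := by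
  have hU : infU (0 : 𝕜) 0 = PowerSeries.C (2⁻¹ : 𝕜) := by simp [infU]
  have hV : ∀ t : 𝕜, infV t 0 0 = 1 + PowerSeries.C t * PowerSeries.X := fun t => by
    simp [infV, PowerSeries.smul_eq_C_mul]
  have hz : (fun _ : 𝕜 => (0 : 𝕜)) ∈ polyOrder 𝕜 2 := Submodule.zero_mem _
  have h := correspondsToPolynomialDeformation_of_family (𝕜 := 𝕜)
    (U := fun _ => PowerSeries.C (2⁻¹ : 𝕜)) (V := fun t => 1 + PowerSeries.C t * PowerSeries.X)
    Polynomial.X 0 0 preservesBracket_densityOp rfl (by simp)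
    (fun n => by simpa only [Polynomial.eval_zero, hU, sub_self] using hz)
    (fun n => by simpa only [Polynomial.eval_zero, Polynomial.eval_X, hV, sub_self] using hz)
    (fun t n _ => by simp only [Polynomial.eval_zero, hU])
    (fun t n _ => by simp only [Polynomial.eval_zero, Polynomial.eval_X, hV]) c
  simpa using h

theorem thetaTwoU_sub_thetaThreeU : thetaTwoU 𝕜 - thetaThreeU 𝕜 = altSeries 𝕜 := by
  ext n
  simp only [thetaTwoU, thetaThreeU, altSeries, map_sub, PowerSeries.coeff_mk]
  split_ifs with h
  · simp
  · have h2 : (n : 𝕜) ≠ 0 := by exact_mod_cast h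
    field_simp
    ring

theorem X_add_thetaTwoV_sub_thetaThreeV :
    PowerSeries.X + thetaTwoV 𝕜 - thetaThreeV 𝕜 = altSeries 𝕜 := by
  ext n
  simp only [thetaTwoV, thetaThreeV, altSeries, map_sub, map_add, PowerSeries.coeff_mk,
    PowerSeries.coeff_X]
  rcases n with _ | _ | n
  · simp
  · simp
  · have h2 : ((n + 1 : ℕ) : 𝕜) + 1 ≠ 0 := by exact_mod_cast Nat.succ_ne_zero (n + 1)
    simp only [show ¬ n + 1 + 1 = 1 by omega, show ¬ n + 1 + 1 ≤ 1 by omega,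
      show ¬ n + 1 + 1 = 0 by omega, if_false, Nat.add_sub_cancel]
    field_simp
    ring

/-- The curve `(c, c, -c)`: densities of weight `c + 1/2` conjugated by `η̄`. -/
theorem corresponds_second_curve (c : 𝕜) : CorrespondsToPolynomialDeformation c c (-c) := by
  have hU : ∀ t : 𝕜, infU t (-t) = PowerSeries.C (2⁻¹ : 𝕜) + t • altSeries 𝕜 := fun t => by
    rw [infU, ← thetaTwoU_sub_thetaThreeU]; module
  have hV : ∀ t : 𝕜, infV t t (-t) = 1 + t • altSeries 𝕜 := fun t => by
    rw [infV, ← X_add_thetaTwoV_sub_thetaThreeV]; module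
  have hz : (fun _ : 𝕜 => (0 : 𝕜)) ∈ polyOrder 𝕜 2 := Submodule.zero_mem _
  have h := correspondsToPolynomialDeformation_of_family (𝕜 := 𝕜)
    (U := fun t => PowerSeries.C (2⁻¹ : 𝕜) + t • altSeries 𝕜) (V := fun t => 1 + t • altSeries 𝕜)
    Polynomial.X Polynomial.X (-Polynomial.X) preservesBracket_altSeries (by simp) (by simp)
    (fun n => by
      simpa only [Polynomial.eval_neg, Polynomial.eval_X, hU, sub_self] using hz)
    (fun n => by
      simpa only [Polynomial.eval_neg, Polynomial.eval_X, hV, sub_self] using hz)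
    (fun t n _ => by simp only [Polynomial.eval_neg, Polynomial.eval_X, hU])
    (fun t n _ => by simp only [Polynomial.eval_neg, Polynomial.eval_X, hV]) c
  simpa using h

theorem choose_two (t : 𝕜) : Ring.choose t 2 = t * (t - 1) / 2 := by
  rw [← choosePoly_eval]
  simp [choosePoly, descPochhammer_succ_right]
  ring

theorem coeff_conj_zero (a : 𝕜) (t : 𝕜) (S : PowerSeries 𝕜) :
    (PowerSeries.binomialSeries 𝕜 (2 * t) * (PowerSeries.C a + t • S)).coeff 0 =
      a + t * S.coeff 0 := by
  simp [PowerSeries.coeff_mul]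

theorem coeff_conj_one (a : 𝕜) (t : 𝕜) (S : PowerSeries 𝕜) :
    (PowerSeries.binomialSeries 𝕜 (2 * t) * (PowerSeries.C a + t • S)).coeff 1 =
      t * S.coeff 1 + 2 * t * (a + t * S.coeff 0) := by
  simp [PowerSeries.coeff_mul, Finset.Nat.antidiagonal_succ]

theorem coeff_conj_two (a : 𝕜) (t : 𝕜) (S : PowerSeries 𝕜) :
    (PowerSeries.binomialSeries 𝕜 (2 * t) * (PowerSeries.C a + t • S)).coeff 2 =
      t * S.coeff 2 + 2 * t * (t * S.coeff 1) + t * (2 * t - 1) * (a + t * S.coeff 0) := by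
  simp [PowerSeries.coeff_mul, Finset.Nat.antidiagonal_succ, choose_two, PowerSeries.coeff_C]
  ring

set_option maxHeartbeats 400000 in
/-- Conjugation by `η^{4t}` of a family `ρ + t (…)` gives a polynomial deformation, provided that
the first order terms and the coefficients of low index match. -/
theorem corresponds_of_conj (S T : PowerSeries 𝕜) (p₁ p₂ p₃ : Polynomial 𝕜)
    (e₁ e₂ e₃ a₁ a₂ a₃ : 𝕜) (h₁ : ∀ t, p₁.eval t = e₁ * t + a₁ * t ^ 2)
    (h₂ : ∀ t, p₂.eval t = e₂ * t + a₂ * t ^ 2) (h₃ : ∀ t, p₃.eval t = e₃ * t + a₃ * t ^ 2)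
    (hom : ∀ t : 𝕜, PreservesBracket (stdOp (PowerSeries.C (2⁻¹ : 𝕜) + t • S)
      (PowerSeries.C 1 + t • T)))
    (hS : ∀ n, logCoeff 𝕜 n + S.coeff n =
      e₂ * (thetaTwoU 𝕜).coeff n + e₃ * (thetaThreeU 𝕜).coeff n)
    (hT : ∀ n, 2 * logCoeff 𝕜 n + T.coeff n = e₁ * PowerSeries.X.coeff n +
      e₂ * (thetaTwoV 𝕜).coeff n + e₃ * (thetaThreeV 𝕜).coeff n)
    (hS0 : S.coeff 0 = 0) (hT0 : T.coeff 0 = 0) (hS1 : ∀ t, t * S.coeff 1 + t = p₂.eval t)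
    (hT1 : ∀ t, t * T.coeff 1 + 2 * t = p₁.eval t)
    (hS2 : ∀ t, t * S.coeff 2 + 2 * t ^ 2 * S.coeff 1 + t * (2 * t - 1) / 2 = p₃.eval t)
    (hT2 : ∀ t, t * T.coeff 2 + 2 * t ^ 2 * T.coeff 1 + t * (2 * t - 1) = -p₂.eval t) (t : 𝕜) :
    CorrespondsToPolynomialDeformation (p₁.eval t) (p₂.eval t) (p₃.eval t) := by
  have hsq : ∀ a : 𝕜, (fun t : 𝕜 => t ^ 2 * a) ∈ polyOrder 𝕜 2 := fun a =>
    ⟨Polynomial.X ^ 2 * Polynomial.C a, dvd_mul_right _ _, fun t => by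
      rw [Polynomial.eval_mul, Polynomial.eval_pow, Polynomial.eval_X, Polynomial.eval_C]⟩
  refine correspondsToPolynomialDeformation_of_family
    (U := fun t => PowerSeries.binomialSeries 𝕜 (2 * t) * (PowerSeries.C (2⁻¹ : 𝕜) + t • S))
    (V := fun t => PowerSeries.binomialSeries 𝕜 (2 * t) * (PowerSeries.C 1 + t • T))
    p₁ p₂ p₃ (fun t => (hom t).binomialSeries_mul (2 * t)) (by simp) (by simp)
    (fun n => ?_) (fun n => ?_) (fun t n hn => ?_) (fun t n hn => ?_) t
  · have h := Submodule.sub_mem _ (coeff_conj_sub_mem (2⁻¹ : 𝕜) S n)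
      (hsq (a₂ * (thetaTwoU 𝕜).coeff n + a₃ * (thetaThreeU 𝕜).coeff n))
    convert h using 1
    funext t
    simp only [infU, h₂, h₃, map_add, map_smul, smul_eq_mul, Pi.sub_apply]
    linear_combination t * hS n
  · have h := Submodule.sub_mem _ (coeff_conj_sub_mem (1 : 𝕜) T n)
      (hsq (a₁ * PowerSeries.X.coeff n + a₂ * (thetaTwoV 𝕜).coeff n +
        a₃ * (thetaThreeV 𝕜).coeff n))
    convert h using 1
    funext t
    simp only [infV, h₁, h₂, h₃, map_add, map_smul, smul_eq_mul, Pi.sub_apply, map_one]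
    linear_combination t * hT n
  · obtain rfl | rfl | rfl : n = 0 ∨ n = 1 ∨ n = 2 := by omega
    · rw [coeff_conj_zero, hS0]
      simp [infU, thetaTwoU, thetaThreeU]
    · rw [coeff_conj_one, hS0]
      simp [infU, thetaTwoU, thetaThreeU]
      linear_combination hS1 t
    · rw [coeff_conj_two, hS0]
      simp [infU, thetaTwoU, thetaThreeU]
      linear_combination hS2 t
  · obtain rfl | rfl | rfl : n = 0 ∨ n = 1 ∨ n = 2 := by omega
    · rw [coeff_conj_zero, hT0]
      simp [infV, thetaTwoV, thetaThreeV]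
    · rw [coeff_conj_one, hT0]
      simp [infV, thetaTwoV, thetaThreeV, PowerSeries.coeff_one]
      linear_combination hT1 t
    · rw [coeff_conj_two, hT0]
      simp [infV, thetaTwoV, thetaThreeV, PowerSeries.coeff_one, PowerSeries.coeff_X]
      linear_combination hT2 t

/-- The curve `(c, c, c² - c/2)`: densities of weight `-c` conjugated by `η^{4c}`. -/
theorem corresponds_third_curve (c : 𝕜) :
    CorrespondsToPolynomialDeformation c c (c ^ 2 - c / 2) := by
  have h := corresponds_of_conj (𝕜 := 𝕜) 0 (-PowerSeries.X) Polynomial.X Polynomial.X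
    (Polynomial.X ^ 2 - Polynomial.C 2⁻¹ * Polynomial.X) 1 1 (-2⁻¹) 0 0 1 (fun t => by simp)
    (fun t => by simp) (fun t => by simp; ring)
    (fun t => by
      have h := preservesBracket_densityOp (-t)
      unfold densityOp at h
      convert h using 2 <;> simp [PowerSeries.smul_eq_C_mul])
    (fun n => ?_) (fun n => ?_) (by simp) (by simp) (fun t => by simp) (fun t => by simp; ring)
    (fun t => by simp; ring) (fun t => by simp [PowerSeries.coeff_X]; ring) c
  · simpa [div_eq_inv_mul] using h
  · simp only [thetaTwoU, thetaThreeU, logCoeff, PowerSeries.coeff_mk]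
    split_ifs with hn
    · simp
    · have h2 : (n : 𝕜) ≠ 0 := by exact_mod_cast hn
      simp
      field_simp
      ring
  · simp only [thetaTwoV, thetaThreeV, logCoeff, PowerSeries.coeff_mk, map_neg,
      PowerSeries.coeff_X]
    rcases n with _ | _ | n
    · simp
    · simp; norm_num
    · have h2 : ((n + 1 : ℕ) : 𝕜) + 1 ≠ 0 := by exact_mod_cast Nat.succ_ne_zero (n + 1)
      simp only [show ¬ n + 1 + 1 = 1 by omega, show ¬ n + 1 + 1 ≤ 1 by omega,
        show ¬ n + 1 + 1 = 0 by omega, if_false, Nat.add_sub_cancel, Nat.cast_succ (n + 1)]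
      field_simp
      ring

/-- The curve `(c, 0, c/2 - c²)`: densities of weight `1/2 - c` conjugated by `η̄^{4c - 1}`. -/
theorem corresponds_fourth_curve (c : 𝕜) :
    CorrespondsToPolynomialDeformation c 0 (c / 2 - c ^ 2) := by
  have h := corresponds_of_conj (𝕜 := 𝕜) (-altSeries 𝕜) (-altSeries 𝕜) Polynomial.X 0
    (Polynomial.C 2⁻¹ * Polynomial.X - Polynomial.X ^ 2) 1 0 2⁻¹ 0 0 (-1) (fun t => by simp)
    (fun t => by simp) (fun t => by simp; ring)
    (fun t => by
      have h := preservesBracket_altSeries (-t)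
      convert h using 2 <;> simp)
    (fun n => ?_) (fun n => ?_) (by simp [altSeries]) (by simp [altSeries])
    (fun t => by simp [altSeries]) (fun t => by simp [altSeries]; ring)
    (fun t => by simp [altSeries]; ring) (fun t => by simp [altSeries]; ring) c
  · simpa [div_eq_inv_mul] using h
  · simp only [thetaTwoU, thetaThreeU, logCoeff, PowerSeries.coeff_mk, map_neg, altSeries]
    split_ifs with hn
    · simp
    · have h2 : (n : 𝕜) ≠ 0 := by exact_mod_cast hn
      simp
      field_simp
      ring
  · simp only [thetaTwoV, thetaThreeV, logCoeff, PowerSeries.coeff_mk, map_neg,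
      PowerSeries.coeff_X, altSeries]
    rcases n with _ | _ | n
    · simp
    · simp; norm_num
    · have h2 : ((n + 1 : ℕ) : 𝕜) + 1 ≠ 0 := by exact_mod_cast Nat.succ_ne_zero (n + 1)
      simp only [show ¬ n + 1 + 1 = 1 by omega, show ¬ n + 1 + 1 ≤ 1 by omega,
        show ¬ n + 1 + 1 = 0 by omega, if_false, Nat.add_sub_cancel, Nat.cast_succ (n + 1)]
      field_simp
      ring

/-! ### Compositions of odd operators -/

/-- The coefficients of `η^{2l} ∘ B`, by the Leibniz rule for powers of `η² = ∂/∂x`. -/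
theorem monomial_two_mul_one_comp_coeff {B : SPDO 𝕜} {b : ℤ} (hB : ∀ k, b < k → B.1 k = 0)
    (l N : ℤ) {J : ℕ} (hJ : b - N + 2 * l < 2 * J) :
    (comp (monomial (2 * l) 1) B).1 N =
      ∑ j ∈ Finset.range J, Ring.choose l j • (dx ^ j) (B.1 (N - 2 * l + 2 * j)) := by
  rw [monomial_one_comp_coeff hB (2 * l) N (K := 2 * J) (by push_cast; exact hJ)]
  clear hJ
  induction J with
  | zero => simp
  | succ J ih =>
    have h1 : ¬ (Even (2 * J + 1) ∨ Odd (2 * l)) := by simp [parity_simps]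
    have h2 : Even (2 * l - ((2 * J : ℕ) : ℤ)) := by simp [parity_simps]
    rw [mul_add, mul_one, Finset.sum_range_succ, Finset.sum_range_succ, Finset.sum_range_succ, ih,
      superChoose, superChoose, if_neg h1, if_pos (Or.inl (even_two_mul J)), zero_smul, add_zero,
      sigmaPow, if_pos h2, dx_pow_eq]
    simp

theorem sum_Icc_eq_sum_range (f : ℤ → SFun 𝕜) (M : ℕ) :
    ∑ m ∈ Finset.Icc (1 - 2 * (M : ℤ)) 2, f m =
      ∑ n ∈ Finset.range (M + 1), (f (2 - 2 * n) + f (1 - 2 * n)) := by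
  induction M with
  | zero =>
    have : Finset.Icc (1 - 2 * ((0 : ℕ) : ℤ)) 2 = {2, 1} := by decide
    rw [this, Finset.sum_pair (by decide)]
    simp
  | succ M ih =>
    rw [Finset.sum_range_succ, ← ih]
    have h : Finset.Icc (1 - 2 * ((M + 1 : ℕ) : ℤ)) 2 = insert (2 - 2 * ((M + 1 : ℕ) : ℤ))
        (insert (1 - 2 * ((M + 1 : ℕ) : ℤ)) (Finset.Icc (1 - 2 * (M : ℤ)) 2)) := by
      ext m
      simp only [Finset.mem_Icc, Finset.mem_insert]
      push_cast
      omega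
    rw [h, Finset.sum_insert (by simp; omega),
      Finset.sum_insert (by simp; omega)]
    abel

/-- The `θ`-free coefficient of `η^{1-2n}`. -/
noncomputable def oddFst (P : SPDO 𝕜) (n : ℕ) : CircleFun 𝕜 := (P.1 (1 - 2 * n)).fst

/-- The coefficient of `θ η^{2-2n}`. -/
noncomputable def evenSnd (P : SPDO 𝕜) (n : ℕ) : CircleFun 𝕜 := (P.1 (2 - 2 * n)).snd

theorem fst_even_of_opPart_one {P : SPDO 𝕜} (hP : opPart 1 P = P) (n : ℕ) :
    (P.1 (2 - 2 * n)).fst = 0 := by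
  have h3 : Even (2 - 2 * (n : ℤ)) := by simp [parity_simps]
  rw [← hP]
  simp [opPart, h3, fst_superPart]

theorem snd_odd_of_opPart_one {P : SPDO 𝕜} (hP : opPart 1 P = P) (n : ℕ) :
    (P.1 (1 - 2 * n)).snd = 0 := by
  have h3 : ¬ Even (1 - 2 * (n : ℤ)) := by simp [parity_simps]
  rw [← hP]
  simp [opPart, h3, snd_superPart]

variable {P Q : SPDO 𝕜}

/-- For odd operators, the even part of the product has coefficients that only involve the
`θ`-free coefficients of `P`. -/
theorem fst_comp_of_odd (hP : opPart 1 P = P) (hP2 : ∀ k, 2 < k → P.1 k = 0)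
    (hQ2 : ∀ k, 2 < k → Q.1 k = 0) (K : ℕ) :
    ((comp P Q).1 (2 - 2 * K)).fst = ∑ n ∈ Finset.range (K + 2), oddFst P n *
      ∑ j ∈ Finset.range (K + 1 - n), Ring.choose (-n : ℤ) j • (circleDeriv ^ j)
        (oddFst Q (K - n - j) + evenSnd Q (K - n - j)) := by
  rw [comp_coeff_eq_sum hP2 hQ2 _ (p := 1 - 2 * ((K + 1 : ℕ) : ℤ)) (by push_cast; omega),
    sum_Icc_eq_sum_range, TrivSqZeroExt.fst_sum]
  refine Finset.sum_congr rfl fun n hn => ?_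
  have hn := Finset.mem_range.1 hn
  have hl : 1 - 2 * (n : ℤ) = 2 * (-n) + 1 := by ring
  rw [TrivSqZeroExt.fst_add, TrivSqZeroExt.fst_mul, fst_even_of_opPart_one hP, zero_mul, zero_add,
    TrivSqZeroExt.fst_mul, oddFst]
  congr 1
  rw [hl, monomial_add_one_comp, etaLeft_coeff,
    monomial_two_mul_one_comp_coeff hQ2 (-n) _ (J := K + 1 - n) (by omega),
    monomial_two_mul_one_comp_coeff hQ2 (-n) _ (J := K + 1 - n) (by omega),
    TrivSqZeroExt.fst_add, fst_sigma, fst_eta, TrivSqZeroExt.fst_sum, TrivSqZeroExt.snd_sum,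
    ← Finset.sum_add_distrib]
  refine Finset.sum_congr rfl fun j hj => ?_
  have hj := Finset.mem_range.1 hj
  have h1 : 2 - 2 * (K : ℤ) - 1 - 2 * (-n) + 2 * j = 1 - 2 * ((K - n - j : ℕ) : ℤ) := by omega
  have h2 : 2 - 2 * (K : ℤ) - 2 * (-n) + 2 * j = 2 - 2 * ((K - n - j : ℕ) : ℤ) := by omega
  rw [h1, h2, TrivSqZeroExt.fst_smul, TrivSqZeroExt.snd_smul, fst_dx_pow, snd_dx_pow, map_add,
    smul_add, oddFst, evenSnd]

theorem snd_comp_of_odd (hP : opPart 1 P = P) (hP2 : ∀ k, 2 < k → P.1 k = 0)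
    (hQ2 : ∀ k, 2 < k → Q.1 k = 0) (L : ℕ) :
    ((comp P Q).1 (1 - 2 * L)).snd = ∑ n ∈ Finset.range (L + 2),
      (evenSnd P n * ∑ j ∈ Finset.range (L + 2 - n), Ring.choose (1 - n : ℤ) j •
          (circleDeriv ^ j) (oddFst Q (L + 1 - n - j)) +
        oddFst P n * (-(∑ j ∈ Finset.range (L + 2 - n), Ring.choose (-n : ℤ) j •
            (circleDeriv ^ j) (evenSnd Q (L + 1 - n - j))) +
          circleDeriv (∑ j ∈ Finset.range (L + 1 - n), Ring.choose (-n : ℤ) j •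
            (circleDeriv ^ j) (oddFst Q (L - n - j))))) := by
  rw [comp_coeff_eq_sum hP2 hQ2 _ (p := 1 - 2 * ((L + 1 : ℕ) : ℤ)) (by push_cast; omega),
    sum_Icc_eq_sum_range, TrivSqZeroExt.snd_sum]
  refine Finset.sum_congr rfl fun n hn => ?_
  have hn := Finset.mem_range.1 hn
  have hl : 1 - 2 * (n : ℤ) = 2 * (-n) + 1 := by ring
  have hl2 : 2 - 2 * (n : ℤ) = 2 * (1 - n) := by ring
  rw [TrivSqZeroExt.snd_add, DualNumber.snd_mul, DualNumber.snd_mul, fst_even_of_opPart_one hP,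
    snd_odd_of_opPart_one hP, zero_mul, zero_mul, zero_add, add_zero, evenSnd, oddFst]
  congr 1
  · congr 1
    rw [hl2, monomial_two_mul_one_comp_coeff hQ2 (1 - n) _ (J := L + 2 - n) (by omega),
      TrivSqZeroExt.fst_sum]
    refine Finset.sum_congr rfl fun j hj => ?_
    have hj := Finset.mem_range.1 hj
    have h1 : 1 - 2 * (L : ℤ) - 2 * (1 - n) + 2 * j = 1 - 2 * ((L + 1 - n - j : ℕ) : ℤ) := by omega
    rw [h1, TrivSqZeroExt.fst_smul, fst_dx_pow, oddFst]
  · congr 1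
    rw [hl, monomial_add_one_comp, etaLeft_coeff,
      monomial_two_mul_one_comp_coeff hQ2 (-n) _ (J := L + 2 - n) (by omega),
      monomial_two_mul_one_comp_coeff hQ2 (-n) _ (J := L + 1 - n) (by omega),
      TrivSqZeroExt.snd_add, snd_sigma, snd_eta, TrivSqZeroExt.fst_sum, TrivSqZeroExt.snd_sum]
    congr 2
    · refine Finset.sum_congr rfl fun j hj => ?_
      have hj := Finset.mem_range.1 hj
      have h1 : 1 - 2 * (L : ℤ) - 1 - 2 * (-n) + 2 * j =
        2 - 2 * ((L + 1 - n - j : ℕ) : ℤ) := by omega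
      rw [h1, TrivSqZeroExt.snd_smul, snd_dx_pow, evenSnd]
    · refine Finset.sum_congr rfl fun j hj => ?_
      have hj := Finset.mem_range.1 hj
      have h1 : 1 - 2 * (L : ℤ) - 2 * (-n) + 2 * j = 1 - 2 * ((L - n - j : ℕ) : ℤ) := by omega
      rw [h1, TrivSqZeroExt.fst_smul, fst_dx_pow, oddFst]

/-! ### Restriction of a homomorphism to odd elements -/

/-- The odd element `g θ`. -/
noncomputable def oddElem (g : CircleFun 𝕜) : SFun 𝕜 := SFun.mk 0 g

theorem fst_oddElem (g : CircleFun 𝕜) : (oddElem g).fst = 0 := by simp [oddElem, SFun.mk]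

theorem snd_oddElem (g : CircleFun 𝕜) : (oddElem g).snd = g := by simp [oddElem, SFun.mk]

theorem IsSuperLieHom.opPart_one_oddElem {φ : SFun 𝕜 → SPDO 𝕜} (h : IsSuperLieHom φ)
    (g : CircleFun 𝕜) : opPart 1 (φ (oddElem g)) = φ (oddElem g) := by
  rw [← h.even]
  congr 1
  ext <;> simp [fst_superPart, snd_superPart, fst_oddElem, snd_oddElem]

/-- On odd elements the supercommutator is the anticommutator, and `[v_{gθ}, v_{g'θ}]` is
`½ v_{gg'}`. -/
theorem IsSuperLieHom.comp_oddElem {φ : SFun 𝕜 → SPDO 𝕜} (h : IsSuperLieHom φ)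
    (g g' : CircleFun 𝕜) : comp (φ (oddElem g)) (φ (oddElem g')) +
      comp (φ (oddElem g')) (φ (oddElem g)) = φ (SFun.mk ((2⁻¹ : 𝕜) • (g * g')) 0) := by
  have hz : ∀ g : CircleFun 𝕜, opPart 0 (φ (oddElem g)) = 0 := fun g => by
    rw [← h.even, ← h.isLinear.map_zero]
    congr 1
    ext <;> simp [fst_superPart, snd_superPart, fst_oddElem]
  have hb : contactBracket (oddElem g) (oddElem g') = SFun.mk ((2⁻¹ : 𝕜) • (g * g')) 0 := by
    ext <;> simp [fst_contactBracket, snd_contactBracket, fst_oddElem, snd_oddElem, SFun.mk]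
  have h0 : ∀ A : SPDO 𝕜, comp 0 A = 0 := fun A => by simpa using smul_comp 0 0 A
  have h0' : ∀ A : SPDO 𝕜, comp A 0 = 0 := fun A => by simpa using comp_smul 0 A 0
  rw [← hb, h.map_bracket]
  simp [superBracket, Fin.sum_univ_two, hz, h.opPart_one_oddElem, h0, h0', sub_eq_add_neg]
  rw [neg_one_smul 𝕜 (comp (φ (oddElem g')) (φ (oddElem g))), neg_neg]

/-! ### Test functions -/

/-- The value of a function at the base point of the circle. -/
noncomputable def evalZero : CircleFun 𝕜 →ₐ[𝕜] 𝕜 :=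
  (Pi.evalAlgHom 𝕜 (fun _ : ℝ => 𝕜) 0).comp (circleSubalgebra 𝕜).val

theorem contDiff_ofReal_comp {f : ℝ → ℝ} (hf : ContDiff ℝ ∞ f) :
    ContDiff ℝ ∞ fun x => (f x : 𝕜) :=
  (RCLike.ofRealCLM (K := 𝕜)).contDiff.comp hf

theorem deriv_ofReal_comp {f : ℝ → ℝ} {f' x : ℝ} (hf : HasDerivAt f f' x) :
    deriv (fun x => (f x : 𝕜)) x = f' := by
  have := ((RCLike.ofRealCLM (K := 𝕜)).hasFDerivAt (x := f x)).comp_hasDerivAt x hf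
  simpa [Function.comp_def] using this.deriv

variable (𝕜) in
/-- The sine function on the circle. -/
noncomputable def sinFun : CircleFun 𝕜 :=
  ⟨fun x => (Real.sin x : 𝕜), contDiff_ofReal_comp Real.contDiff_sin, fun x => by simp⟩

variable (𝕜) in
/-- The cosine function on the circle. -/
noncomputable def cosFun : CircleFun 𝕜 :=
  ⟨fun x => (Real.cos x : 𝕜), contDiff_ofReal_comp Real.contDiff_cos, fun x => by simp⟩

theorem circleDeriv_sinFun : circleDeriv (sinFun 𝕜) = cosFun 𝕜 :=
  Subtype.ext (funext fun x => deriv_ofReal_comp (Real.hasDerivAt_sin x))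

theorem circleDeriv_cosFun : circleDeriv (cosFun 𝕜) = -sinFun 𝕜 :=
  Subtype.ext (funext fun x => (deriv_ofReal_comp (Real.hasDerivAt_cos x)).trans
    (RCLike.ofReal_neg _))

theorem evalZero_sinFun : evalZero (sinFun 𝕜) = 0 := by
  change ((Real.sin 0 : ℝ) : 𝕜) = 0
  simp

theorem evalZero_cosFun : evalZero (cosFun 𝕜) = 1 := by
  change ((Real.cos 0 : ℝ) : 𝕜) = 1
  simp

/-! ### The obstruction -/

/-- A homomorphism that agrees with `ρ + c₁ Θ₁ + c₂ Θ₂ + c₃ Θ₃` up to terms in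
`η^{-4}, η^{-5}, …`, as do the members of a polynomial deformation. -/
structure IsLift (c₁ c₂ c₃ : 𝕜) (φ : SFun 𝕜 → SPDO 𝕜) : Prop where
  hom : IsSuperLieHom φ
  coeff_eq : ∀ F k, -4 < k → (φ F).1 k = (infinitesimalDeformation c₁ c₂ c₃ F).1 k


variable {c₁ c₂ c₃ : 𝕜} {φ : SFun 𝕜 → SPDO 𝕜}

theorem IsLift.eq_zero (h : IsLift c₁ c₂ c₃ φ) (F : SFun 𝕜) (k : ℤ) (hk : 2 < k) :
    (φ F).1 k = 0 := by
  rw [h.coeff_eq F k (by omega), infinitesimalDeformation_eq_stdOp, stdOp_eq_zero _ _ _ hk]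

theorem IsLift.oddFst_eq (h : IsLift c₁ c₂ c₃ φ) (g : CircleFun 𝕜) (n : ℕ) (hn : n ≤ 2) :
    oddFst (φ (oddElem g)) n = (infU c₂ c₃).coeff n • (circleDeriv ^ n) g := by
  rw [oddFst, h.coeff_eq _ _ (by omega), infinitesimalDeformation_eq_stdOp, stdOp_odd_fst,
    snd_oddElem]

theorem IsLift.evenSnd_eq (h : IsLift c₁ c₂ c₃ φ) (g : CircleFun 𝕜) (n : ℕ) (hn : n ≤ 2) :
    evenSnd (φ (oddElem g)) n =
      ((infV c₁ c₂ c₃).coeff n - 2 * (infU c₂ c₃).coeff n) • (circleDeriv ^ n) g := by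
  rw [evenSnd, h.coeff_eq _ _ (by omega), infinitesimalDeformation_eq_stdOp, stdOp_even_snd,
    snd_oddElem]

theorem coeff_infU_zero : (infU c₂ c₃).coeff 0 = 2⁻¹ := by simp [infU, thetaTwoU, thetaThreeU]

theorem coeff_infU_one : (infU c₂ c₃).coeff 1 = c₂ := by
  simp [infU, thetaTwoU, thetaThreeU]; ring

theorem coeff_infU_two : (infU c₂ c₃).coeff 2 = c₃ := by
  simp [infU, thetaTwoU, thetaThreeU]; ring

theorem coeff_infV_zero : (infV c₁ c₂ c₃).coeff 0 = 1 := by simp [infV, thetaTwoV, thetaThreeV]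

theorem coeff_infV_one : (infV c₁ c₂ c₃).coeff 1 = c₁ := by
  simp [infV, thetaTwoV, thetaThreeV, PowerSeries.coeff_one]

theorem coeff_infV_two : (infV c₁ c₂ c₃).coeff 2 = -c₂ := by
  simp [infV, thetaTwoV, thetaThreeV, PowerSeries.coeff_one, PowerSeries.coeff_X]; ring


theorem choose_neg_one_two : Ring.choose (-1 : ℤ) 2 = 1 := by decide

theorem choose_neg_one_three : Ring.choose (-1 : ℤ) 3 = -1 := by decide

theorem choose_neg_two_two : Ring.choose (-2 : ℤ) 2 = 3 := by decide

theorem circleDeriv_two_mul (f : CircleFun 𝕜) : circleDeriv (2 * f) = 2 * circleDeriv f := by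
  rw [two_mul, map_add, two_mul]

/-- The coefficients of `φ(fθ) ∘ φ(gθ)` at `η^{-2}`, `η^{-4}`, `η^{-6}` and `θη^{-5}`, of which this
is the first, involve the unknown part of `φ` only through the coefficients of `η^{-5}`, `η^{-7}`
and of `θη^{-4}`, `θη^{-6}`. -/
theorem IsLift.evalZero_fst_comp_two (h : IsLift c₁ c₂ c₃ φ) (f g : CircleFun 𝕜) :
    evalZero ((comp (φ (oddElem f)) (φ (oddElem g))).1 (2 - 2 * (2 : ℕ))).fst =
      2⁻¹ * evalZero f * ((-c₂ - c₃) * evalZero (circleDeriv (circleDeriv g))) +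
      c₂ * evalZero (circleDeriv f) * ((c₁ - c₂ - 2⁻¹) * evalZero (circleDeriv g)) +
      c₃ * evalZero (circleDeriv (circleDeriv f)) * (2⁻¹ * evalZero g) := by
  rw [fst_comp_of_odd (h.hom.opPart_one_oddElem f) (h.eq_zero _) (h.eq_zero (oddElem g)) 2]
  simp [Finset.sum_range_succ, h.oddFst_eq, h.evenSnd_eq, coeff_infU_zero, coeff_infU_one,
    coeff_infU_two, coeff_infV_zero, coeff_infV_one, coeff_infV_two, pow_succ']
  ring

theorem IsLift.evalZero_fst_comp_three (h : IsLift c₁ c₂ c₃ φ) (f g : CircleFun 𝕜) :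
    evalZero ((comp (φ (oddElem f)) (φ (oddElem g))).1 (2 - 2 * (3 : ℕ))).fst =
      2⁻¹ * evalZero f *
        (evalZero (oddFst (φ (oddElem g)) 3) + evalZero (evenSnd (φ (oddElem g)) 3)) +
      c₂ * evalZero (circleDeriv f) *
        ((2⁻¹ - c₁ - c₃) * evalZero (circleDeriv (circleDeriv g))) +
      c₃ * evalZero (circleDeriv (circleDeriv f)) *
        ((c₁ - c₂ - 1) * evalZero (circleDeriv g)) +
      evalZero (oddFst (φ (oddElem f)) 3) * (2⁻¹ * evalZero g) := by
  rw [fst_comp_of_odd (h.hom.opPart_one_oddElem f) (h.eq_zero _) (h.eq_zero (oddElem g)) 3]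
  simp [Finset.sum_range_succ, h.oddFst_eq, h.evenSnd_eq, coeff_infU_zero, coeff_infU_one,
    coeff_infU_two, coeff_infV_zero, coeff_infV_one, coeff_infV_two, pow_succ',
    choose_neg_one_two, map_ofNat evalZero]
  ring

theorem IsLift.evalZero_fst_comp_four (h : IsLift c₁ c₂ c₃ φ) (f g : CircleFun 𝕜) :
    evalZero ((comp (φ (oddElem f)) (φ (oddElem g))).1 (2 - 2 * (4 : ℕ))).fst =
      2⁻¹ * evalZero f *
        (evalZero (oddFst (φ (oddElem g)) 4) + evalZero (evenSnd (φ (oddElem g)) 4)) +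
      c₂ * evalZero (circleDeriv f) *
        (evalZero (oddFst (φ (oddElem g)) 3) + evalZero (evenSnd (φ (oddElem g)) 3) +
          (c₁ + c₃ - 2⁻¹) * evalZero (circleDeriv (circleDeriv (circleDeriv g)))) +
      c₃ * evalZero (circleDeriv (circleDeriv f)) *
        ((c₂ - c₃ - 2 * c₁ + 3 / 2) * evalZero (circleDeriv (circleDeriv g))) +
      evalZero (oddFst (φ (oddElem f)) 3) * ((c₁ - c₂ - 3 / 2) * evalZero (circleDeriv g)) +
      evalZero (oddFst (φ (oddElem f)) 4) * (2⁻¹ * evalZero g) := by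
  rw [fst_comp_of_odd (h.hom.opPart_one_oddElem f) (h.eq_zero _) (h.eq_zero (oddElem g)) 4]
  simp [Finset.sum_range_succ, h.oddFst_eq, h.evenSnd_eq, coeff_infU_zero, coeff_infU_one,
    coeff_infU_two, coeff_infV_zero, coeff_infV_one, coeff_infV_two, pow_succ',
    choose_neg_one_two, choose_neg_one_three, choose_neg_two_two, map_ofNat evalZero]
  ring

theorem IsLift.evalZero_snd_comp_three (h : IsLift c₁ c₂ c₃ φ) (f g : CircleFun 𝕜) :
    evalZero ((comp (φ (oddElem f)) (φ (oddElem g))).1 (1 - 2 * (3 : ℕ))).snd =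
      2⁻¹ * evalZero f * (evalZero (circleDeriv (oddFst (φ (oddElem g)) 3)) -
        evalZero (evenSnd (φ (oddElem g)) 4)) +
      evalZero (circleDeriv f) * ((c₁ - 2 * c₂) * evalZero (oddFst (φ (oddElem g)) 3) +
        c₂ * ((2⁻¹ - c₁ - c₃) * evalZero (circleDeriv (circleDeriv (circleDeriv g))) -
          evalZero (evenSnd (φ (oddElem g)) 3))) +
      evalZero (circleDeriv (circleDeriv f)) * (((-c₂ - 2 * c₃) * (c₃ - c₂ + 2⁻¹) +
        c₃ * (2 * c₁ - 2 * c₂ + 2 * c₃ - 1)) * evalZero (circleDeriv (circleDeriv g))) +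
      evalZero (evenSnd (φ (oddElem f)) 3) * ((c₂ - 1) * evalZero (circleDeriv g)) +
      evalZero (oddFst (φ (oddElem f)) 3) *
        ((2 * c₂ - c₁ + 2⁻¹) * evalZero (circleDeriv g)) +
      evalZero (evenSnd (φ (oddElem f)) 4) * (2⁻¹ * evalZero g) := by
  rw [snd_comp_of_odd (h.hom.opPart_one_oddElem f) (h.eq_zero _) (h.eq_zero (oddElem g)) 3]
  simp [Finset.sum_range_succ, h.oddFst_eq, h.evenSnd_eq, coeff_infU_zero, coeff_infU_one,
    coeff_infU_two, coeff_infV_zero, coeff_infV_one, coeff_infV_two, pow_succ',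
    choose_neg_one_two, map_ofNat evalZero, circleDeriv_two_mul]
  ring

/-- The anticommutator of `φ(fθ)` and `φ(gθ)` only depends on the product `fg`. -/
theorem IsSuperLieHom.comp_add_comp_congr (h : IsSuperLieHom φ) {f g f' g' : CircleFun 𝕜}
    (hfg : f * g = f' * g') :
    comp (φ (oddElem f)) (φ (oddElem g)) + comp (φ (oddElem g)) (φ (oddElem f)) =
      comp (φ (oddElem f')) (φ (oddElem g')) + comp (φ (oddElem g')) (φ (oddElem f')) := by
  rw [h.comp_oddElem, h.comp_oddElem, hfg]

theorem IsSuperLieHom.evalZero_fst_congr (h : IsSuperLieHom φ) {f g f' g' : CircleFun 𝕜}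
    (hfg : f * g = f' * g') (k : ℤ) :
    evalZero ((comp (φ (oddElem f)) (φ (oddElem g))).1 k).fst +
        evalZero ((comp (φ (oddElem g)) (φ (oddElem f))).1 k).fst =
      evalZero ((comp (φ (oddElem f')) (φ (oddElem g'))).1 k).fst +
        evalZero ((comp (φ (oddElem g')) (φ (oddElem f'))).1 k).fst := by
  simpa using congrArg (fun A : SPDO 𝕜 => evalZero (A.1 k).fst) (h.comp_add_comp_congr hfg)

theorem IsSuperLieHom.evalZero_snd_congr (h : IsSuperLieHom φ) {f g f' g' : CircleFun 𝕜}
    (hfg : f * g = f' * g') (k : ℤ) :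
    evalZero ((comp (φ (oddElem f)) (φ (oddElem g))).1 k).snd +
        evalZero ((comp (φ (oddElem g)) (φ (oddElem f))).1 k).snd =
      evalZero ((comp (φ (oddElem f')) (φ (oddElem g'))).1 k).snd +
        evalZero ((comp (φ (oddElem g')) (φ (oddElem f'))).1 k).snd := by
  simpa using congrArg (fun A : SPDO 𝕜 => evalZero (A.1 k).snd) (h.comp_add_comp_congr hfg)

/-- The coefficient of `η^{-2}` gives the first condition. Those of `η^{-4}`, `θη^{-5}`, `η^{-6}`
give relations between `c₁, c₂, c₃` and the unknown coefficients of `φ`. The products of two test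
functions coincide in the pairs `sin x cos x · 1 = cos x · sin x`,
`sin x cos x · sin x = cos x · sin² x` and `sin² x · 1 = sin x · sin x`, so that each pair gives an
equation in which the value of `φ` on the product cancels. All other unknowns then drop out of one
linear combination of these equations, evaluated at `x = 0`. -/
theorem IsLift.obstruction (h : IsLift c₁ c₂ c₃ φ) : c₂ * (c₁ - c₂) = 0 ∧
    (c₂ = 0 → c₃ * (c₁ - 2 * c₁ ^ 2 - 2 * c₃) = 0) ∧
    (c₂ = c₁ → (c₃ + c₁) * (2 * c₃ + c₁ - 2 * c₁ ^ 2) = 0) := by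
  obtain ⟨s, hs0, hs1, hs2, hs3⟩ : ∃ s, s = sinFun 𝕜 ∧ evalZero (circleDeriv s) = 1 ∧
      evalZero (circleDeriv (circleDeriv s)) = 0 ∧
      evalZero (circleDeriv (circleDeriv (circleDeriv s))) = -1 :=
    ⟨_, rfl, by simp [circleDeriv_sinFun, circleDeriv_cosFun, evalZero_sinFun, evalZero_cosFun]⟩
  obtain ⟨c, hc0, hc1, hc2, hc3⟩ : ∃ c, c = cosFun 𝕜 ∧ evalZero (circleDeriv c) = 0 ∧
      evalZero (circleDeriv (circleDeriv c)) = -1 ∧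
      evalZero (circleDeriv (circleDeriv (circleDeriv c))) = 0 :=
    ⟨_, rfl, by simp [circleDeriv_sinFun, circleDeriv_cosFun, evalZero_sinFun, evalZero_cosFun]⟩
  obtain ⟨p, hp0, hp1, hp2, hp3⟩ : ∃ p, p = sinFun 𝕜 * cosFun 𝕜 ∧ evalZero (circleDeriv p) = 1 ∧
      evalZero (circleDeriv (circleDeriv p)) = 0 ∧
      evalZero (circleDeriv (circleDeriv (circleDeriv p))) = -4 :=
    ⟨_, rfl, by
      simp [circleDeriv_mul, circleDeriv_sinFun, circleDeriv_cosFun, evalZero_sinFun,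
        evalZero_cosFun]
      norm_num⟩
  obtain ⟨q, hq0, hq1, hq2, hq3⟩ : ∃ q, q = sinFun 𝕜 * sinFun 𝕜 ∧ evalZero (circleDeriv q) = 0 ∧
      evalZero (circleDeriv (circleDeriv q)) = 2 ∧
      evalZero (circleDeriv (circleDeriv (circleDeriv q))) = 0 :=
    ⟨_, rfl, by
      simp [circleDeriv_mul, circleDeriv_sinFun, circleDeriv_cosFun, evalZero_sinFun,
        evalZero_cosFun]
      norm_num⟩
  obtain ⟨e, he0, he1⟩ : ∃ e : CircleFun 𝕜, e = 1 ∧ circleDeriv e = 0 := ⟨1, rfl, circleDeriv_one⟩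
  have m1 : p * e = c * s := by rw [hp0, hc0, he0, hs0]; ring
  have m2 : p * s = c * q := by rw [hp0, hc0, hq0, hs0]; ring
  have m3 : q * e = s * s := by rw [hq0, he0, hs0]; ring
  replace hs0 : evalZero s = 0 := by rw [hs0, evalZero_sinFun]
  replace hc0 : evalZero c = 1 := by rw [hc0, evalZero_cosFun]
  replace hp0 : evalZero p = 0 := by rw [hp0, map_mul, evalZero_sinFun, zero_mul]
  replace hq0 : evalZero q = 0 := by rw [hq0, map_mul, evalZero_sinFun, zero_mul]
  replace he0 : evalZero e = 1 := by rw [he0, map_one]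
  have k2 := h.hom.evalZero_fst_congr m3 (2 - 2 * (2 : ℕ))
  have k3 := h.hom.evalZero_fst_congr m1 (2 - 2 * (3 : ℕ))
  have k4 := h.hom.evalZero_fst_congr m2 (2 - 2 * (4 : ℕ))
  have k4' := h.hom.evalZero_fst_congr m3 (2 - 2 * (4 : ℕ))
  have l3 := h.hom.evalZero_snd_congr m2 (1 - 2 * (3 : ℕ))
  have l3' := h.hom.evalZero_snd_congr m3 (1 - 2 * (3 : ℕ))
  simp only [h.evalZero_fst_comp_two, h.evalZero_fst_comp_three, h.evalZero_fst_comp_four,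
    h.evalZero_snd_comp_three, hs0, hs1, hs2, hs3, hc0, hc1, hc2, hc3, hp0, hp1, hp2, hp3, hq0, hq1,
    hq2, hq3, he0, he1, map_zero] at k2 k3 k4 k4' l3 l3'
  -- in `k4 + k4'` and `l3 + l3'` the coefficients of `η^{-7}` and `θη^{-6}` cancel, as do the
  -- derivatives of those of `η^{-5}`; the multipliers below cancel those of `η^{-5}` and `θη^{-4}`
  refine ⟨by linear_combination -k2 / 2, fun h2 => ?_, fun h2 => ?_⟩
  · subst h2
    linear_combination -5⁻¹ * ((c₁ - 3 / 2) * (l3 + l3') - 5 / 2 * (k4 + k4') +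
      2 * (c₁ - 3 / 2) * k3)
  · subst h2
    linear_combination 5⁻¹ * ((-c₂ - 3 / 2) * (l3 + l3') - 5 / 2 * (k4 + k4') +
      (3 * c₂ - 3) * k3)

end SuperCircle

theorem mainTheorem1 {𝕜 : Type*} [RCLike 𝕜] (c₁ c₂ c₃ : 𝕜) :
    SuperCircle.CorrespondsToPolynomialDeformation c₁ c₂ c₃ ↔
      (3 * c₁ * c₃ - 2 * c₁ ^ 3 - 2 * c₁ ^ 2 * c₃ + c₁ ^ 2 + 2 * c₃ ^ 2 = 0 ∧ c₁ = c₂) ∨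
      (c₃ * c₁ - 2 * c₃ * c₁ ^ 2 - 2 * c₃ ^ 2 = 0 ∧ c₂ = 0) := by
  constructor
  · rintro ⟨n, φ, γ₁, γ₂, γ₃, R, hφ, hR, -, hord, t, rfl, rfl, rfl⟩
    have h : SuperCircle.IsLift (γ₁.eval t) (γ₂.eval t) (γ₃.eval t) (φ t) :=
      ⟨hφ.hom t, fun F k hk => by
        rw [hR t F, Submodule.coe_add, Pi.add_apply, hord t F k hk, add_zero]⟩
    obtain ⟨h1, h2, h3⟩ := h.obstruction
    rcases mul_eq_zero.1 h1 with h0 | h0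
    · exact Or.inr ⟨by linear_combination h2 h0, h0⟩
    · have h0 := sub_eq_zero.1 h0
      exact Or.inl ⟨by linear_combination h3 h0.symm, h0⟩
  · rintro (⟨h, rfl⟩ | ⟨h, rfl⟩)
    · have hf : (c₃ + c₁) * (2 * c₃ + c₁ - 2 * c₁ ^ 2) = 0 := by linear_combination h
      rcases mul_eq_zero.1 hf with h0 | h0
      · obtain rfl : c₃ = -c₁ := eq_neg_of_add_eq_zero_left h0
        exact SuperCircle.corresponds_second_curve c₁
      · obtain rfl : c₃ = c₁ ^ 2 - c₁ / 2 := by linear_combination h0 / 2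
        exact SuperCircle.corresponds_third_curve c₁
    · have hf : c₃ * (c₁ - 2 * c₁ ^ 2 - 2 * c₃) = 0 := by linear_combination h
      rcases mul_eq_zero.1 hf with rfl | h0
      · exact SuperCircle.corresponds_first_curve c₁
      · obtain rfl : c₃ = c₁ / 2 - c₁ ^ 2 := by linear_combination -h0 / 2
        exact SuperCircle.corresponds_fourth_curve c₁
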